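/- **Theorem (Iteration complexity of Perturbed Smoothed GDA).** Consider $\min_{x\in\mathcal X}\max_{y\in\mathcal Y} f(x,y)$, where $\mathcal X\subseteq\mathbb R^n$ is closed and convex, $\mathcal Y\subseteq\mathbb R^d$ is compact and convex with $0\in\mathcal Y$ and diameter $D_{\mathcal Y}>0$, and $f:\mathbb R^n\times\mathbb R^d\to\mathbb R$ is continuously differentiable, concave in $y$ on $\mathcal Y$ for each $x\in\mathcal X$, and $\ell$-smooth with $\ell>0$: for all $x,x'\in\mathcal X$, $y,y'\in\mathcal Y$, $$\|\nabla_x f(x,y)-\nabla_x f(x',y')\|\le \ell(\|x-x'\|+\|y-y'\|),\qquad \|\nabla_y f(x,y)-\nabla_y f(x',y')\|\le \ell(\|x-x'\|+\|y-y'\|).$$ Assume $\inf_{x\in\mathcal X}\max_{y\in\mathcal Y}f(x,y)>-\infty$. *Stationarity.* Let $\iota_K$ be the indicator function of a set $K$ ($0$ on $K$, $+\infty$ elsewhere) and $\Phi(x)=\max_{y\in\mathcal Y}f(x,y)+\iota_{\mathcal X}(x)$. A point $x\in\mathcal X$ is an $\epsilon$-optimization-stationary point if $\|\mathrm{prox}_{\frac1{2\ell}\Phi}(x)-x\|\le\frac{\epsilon}{2\ell}$,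 where $\mathrm{prox}_{\frac1{2\ell}\Phi}(x)=\arg\min_u\{\Phi(u)+\ell\|u-x\|^2\}$. A pair $(x,y)\in\mathcal X\times\mathcal Y$ is an $\epsilon$-game-stationary point if $\mathrm{dist}(0,\nabla_xf(x,y)+\partial\iota_{\mathcal X}(x))\le\epsilon$ and $\mathrm{dist}(0,-\nabla_yf(x,y)+\partial\iota_{\mathcal Y}(y))\le\epsilon$. *Algorithm.* Let $\widetilde f(x,y)=f(x,y)-\frac{r_y}2\|y\|^2$ and $\widetilde F(x,y,z)=\widetilde f(x,y)+\frac{r_x}{2}\|x-z\|^2$. From $x_0\in\mathcal X$, $y_0\in\mathcal Y$, $z_0\in\mathbb R^n$, Perturbed Smoothed GDA iterates $$x_{t+1}=\mathrm{proj}_{\mathcal X}(x_t-c\nabla_x\widetilde F(x_t,y_t,z_t)),\quad y_{t+1}=\mathrm{proj}_{\mathcal Y}(y_t+\alpha\nabla_y\widetilde F(x_{t+1},y_t,z_t)),\quad z_{t+1}=z_t+\beta(x_{t+1}-z_t).$$ Its initial gap is $\Delta_{\Psi_2}=\Psi_2(x_0,y_0,z_0)-\inf_{x\in\mathcal X}\max_{y\in\mathcal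 Y}\widetilde f(x,y)$, where $$\Psi_2(x,y,z)=\widetilde F(x,y,z)-2\min_{x'\in\mathcal X}\widetilde F(x',y,z)+2\min_{x'\in\mathcal X}\max_{y'\in\mathcal Y}\widetilde F(x',y',z).$$ *Parameters.* For $0<m\le M$, write $u=\Theta_{m,M}(v)$ for $mv\le u\le Mv$. Fix $m,M$. The parameters satisfy $0<r_y\le\ell$ and - $r_x=\Theta_{m,M}(\ell)$ and $r_x>3\ell$; - $\alpha=\Theta_{m,M}(1/\ell)$ and $0<\alpha\le\min\left\{\frac1{11\ell},\frac{c^2(r_x-\ell)^2}{4\ell(1+c(r_x-\ell))^2}\right\}$; - $c=\Theta_{m,M}(1/\ell)$ and $0<c<\frac1{r_x+\ell}$; - $\beta=\Theta_{m,M}(r_y/\ell)$ and $0<\beta\le\min\left\{\frac1{36},\frac{(r_x-\ell)^2}{384r_x(r_x+\ell)^2},\frac1{384r_x\alpha\omega^2}\right\}$, where $\omega=\frac1{\sqrt{2r_y}}\cdot\frac{(r_x-\ell)+\alpha\ell(3r_x-2\ell)}{\alpha(r_x-\ell)^{3/2}}$. Then the following hold for every $\epsilon>0$. (i) (Game stationarity)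 For every $\kappa<1$ there is a constant $C>0$, depending only on $m,M,\kappa$, such that if $m\frac{\epsilon}{D_{\mathcal Y}}\le r_y\le\kappa\frac{\epsilon}{D_{\mathcal Y}}$, then there is an index $t\ge 0$ with $$t\le C\,\frac{\ell^2D_{\mathcal Y}\Delta_{\Psi_2}}{\epsilon^3}$$ such that $(x_{t+1},y_{t+1})$ is an $\epsilon$-game-stationary point. (ii) (Optimization stationarity) For every $\kappa<\frac14$ there is a constant $C>0$, depending only on $m,M,\kappa$, such that if $m\frac{\epsilon^2}{\ell D_{\mathcal Y}^2}\le r_y\le\kappa\frac{\epsilon^2}{\ell D_{\mathcal Y}^2}$, then there is an index $t\ge0$ with $$t\le C\,\frac{\ell^3D_{\mathcal Y}^2\Delta_{\Psi_2}}{\epsilon^4}$$ such that $x_{t+1}$ is an $\epsilon$-optimization-stationary point. -/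

import Mathlib

/-- `ℝⁿ` with its Euclidean norm. -/
abbrev RVec (n : ℕ) : Type := EuclideanSpace ℝ (Fin n)

/-- `u = Θ(v)` with lower constant `m` and upper constant `M`. -/
def IsThetaWith (m M u v : ℝ) : Prop := m * v ≤ u ∧ u ≤ M * v

/-- `p` is a Euclidean projection of `u` onto `K`, i.e. a nearest point of `K`
(it exists and is unique when `K` is nonempty, closed and convex). -/
def IsProjOnto {n : ℕ} (K : Set (RVec n)) (u p : RVec n) : Prop :=
  p ∈ K ∧ ∀ w ∈ K, ‖p - u‖ ≤ ‖w - u‖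

/-- The subdifferential `∂ι_K(u)` of the indicator function of `K`: all `v` with
`ι_K(w) ≥ ι_K(u) + ⟪v, w - u⟫` for every `w`; it is empty when `u ∉ K`. -/
def indicatorSubdiff {n : ℕ} (K : Set (RVec n)) (u : RVec n) : Set (RVec n) :=
  {v | u ∈ K ∧ ∀ w ∈ K, inner ℝ v (w - u) ≤ 0}

/-- The partial gradient `∇ₓ f(x, y)`. -/
noncomputable def gradX {n d : ℕ} (f : RVec n → RVec d → ℝ) (x : RVec n) (y : RVec d) : RVec n :=
  gradient (fun x' => f x' y) x

/-- The partial gradient `∇_y f(x, y)`. -/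
noncomputable def gradY {n d : ℕ} (f : RVec n → RVec d → ℝ) (x : RVec n) (y : RVec d) : RVec d :=
  gradient (fun y' => f x y') y

/-- The primal value function `max_{y ∈ Y} f(x, y)`. -/
noncomputable def primalValue {n d : ℕ} (Y : Set (RVec d)) (f : RVec n → RVec d → ℝ)
    (x : RVec n) : ℝ :=
  ⨆ y : Y, f x y

/-- `ℓ`-smoothness: `f` is continuously differentiable and both partial gradients satisfy the
Lipschitz estimate with constant `ℓ > 0` on `X × Y`. -/
structure IsSmoothOn {n d : ℕ} (X : Set (RVec n)) (Y : Set (RVec d))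
    (f : RVec n → RVec d → ℝ) (ℓ : ℝ) : Prop where
  pos : 0 < ℓ
  contDiff : ContDiff ℝ 1 (fun p : RVec n × RVec d => f p.1 p.2)
  lipX : ∀ x ∈ X, ∀ x' ∈ X, ∀ y ∈ Y, ∀ y' ∈ Y,
    ‖gradX f x y - gradX f x' y'‖ ≤ ℓ * (‖x - x'‖ + ‖y - y'‖)
  lipY : ∀ x ∈ X, ∀ x' ∈ X, ∀ y ∈ Y, ∀ y' ∈ Y,
    ‖gradY f x y - gradY f x' y'‖ ≤ ℓ * (‖x - x'‖ + ‖y - y'‖)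

/-- The standing assumptions on `min_{x ∈ X} max_{y ∈ Y} f(x, y)`, the diameter of the dual domain
being `Metric.diam Y`. The last field says that the value of the problem is not `-∞`. -/
structure IsNCCProblem {n d : ℕ} (X : Set (RVec n)) (Y : Set (RVec d))
    (f : RVec n → RVec d → ℝ) (ℓ : ℝ) : Prop where
  closed_X : IsClosed X
  convex_X : Convex ℝ X
  compact_Y : IsCompact Y
  convex_Y : Convex ℝ Y
  zero_mem_Y : (0 : RVec d) ∈ Y
  diam_pos : 0 < Metric.diam Y
  smooth : IsSmoothOn X Y f ℓ
  concave : ∀ x ∈ X, ConcaveOn ℝ Y (f x)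
  bddBelow : BddBelow (primalValue Y f '' X)

/-- `(x, y)` is an `ε`-game-stationary point. -/
def IsGameStationary {n d : ℕ} (X : Set (RVec n)) (Y : Set (RVec d))
    (f : RVec n → RVec d → ℝ) (ε : ℝ) (x : RVec n) (y : RVec d) : Prop :=
  x ∈ X ∧ y ∈ Y ∧
  Metric.infDist 0 ((fun v => gradX f x y + v) '' indicatorSubdiff X x) ≤ ε ∧
  Metric.infDist 0 ((fun v => -gradY f x y + v) '' indicatorSubdiff Y y) ≤ ε

/-- `p = prox_{sΦ}(x)`, where `Φ` is the primal value function plus the indicator function of `X`: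
`p` minimizes `Φ(u) + ‖u - x‖² / (2s)`. -/
def IsProx {n d : ℕ} (X : Set (RVec n)) (Y : Set (RVec d))
    (f : RVec n → RVec d → ℝ) (s : ℝ) (x p : RVec n) : Prop :=
  p ∈ X ∧ IsMinOn (fun u => primalValue Y f u + 1 / (2 * s) * ‖u - x‖ ^ 2) X p

/-- `x` is an `ε`-optimization-stationary point:
`‖prox_{Φ/(2ℓ)}(x) - x‖ ≤ ε / (2ℓ)`. -/
def IsOptStationary {n d : ℕ} (X : Set (RVec n)) (Y : Set (RVec d))
    (f : RVec n → RVec d → ℝ) (ℓ ε : ℝ) (x : RVec n) : Prop :=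
  x ∈ X ∧ ∃ p, IsProx X Y f (1 / (2 * ℓ)) x p ∧ ‖p - x‖ ≤ ε / (2 * ℓ)

/-- The perturbed objective `f(x, y) - (r_y / 2) ‖y‖²`. -/
noncomputable def pertObj {n d : ℕ} (f : RVec n → RVec d → ℝ) (ry : ℝ)
    (x : RVec n) (y : RVec d) : ℝ :=
  f x y - ry / 2 * ‖y‖ ^ 2

/-- The surrogate `F(x, y, z) = f(x, y) + (r_x / 2) ‖x - z‖² - (r_y / 2) ‖y‖²`
(the argument `z` comes first). -/
noncomputable def surrogate {n d : ℕ} (f : RVec n → RVec d → ℝ) (rx ry : ℝ) (z : RVec n)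
    (x : RVec n) (y : RVec d) : ℝ :=
  f x y + rx / 2 * ‖x - z‖ ^ 2 - ry / 2 * ‖y‖ ^ 2

/-- The potential `Ψ₂(x, y, z)`. -/
noncomputable def potential {n d : ℕ} (X : Set (RVec n)) (Y : Set (RVec d))
    (f : RVec n → RVec d → ℝ) (rx ry : ℝ) (x : RVec n) (y : RVec d) (z : RVec n) : ℝ :=
  surrogate f rx ry z x y - 2 * (⨅ u : X, surrogate f rx ry z u y)
    + 2 * (⨅ u : X, ⨆ v : Y, surrogate f rx ry z u v)

/-- The initial gap `Δ = Ψ₂(x₀, y₀, z₀) - min_{x ∈ X} max_{y ∈ Y} (f(x, y) - (r_y / 2) ‖y‖²)`. -/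
noncomputable def initialGap {n d : ℕ} (X : Set (RVec n)) (Y : Set (RVec d))
    (f : RVec n → RVec d → ℝ) (rx ry : ℝ) (x₀ : RVec n) (y₀ : RVec d) (z₀ : RVec n) : ℝ :=
  potential X Y f rx ry x₀ y₀ z₀ - ⨅ u : X, ⨆ v : Y, pertObj f ry u v

/-- The sequence `(x_t, y_t, z_t)` is generated by Perturbed Smoothed GDA with smoothing parameter
`rx`, perturbation parameter `ry` and step sizes `c`, `α`, `β`. -/
structure IsPerturbedSmoothedGDA {n d : ℕ} (X : Set (RVec n)) (Y : Set (RVec d))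
    (f : RVec n → RVec d → ℝ) (rx ry c α β : ℝ)
    (x : ℕ → RVec n) (y : ℕ → RVec d) (z : ℕ → RVec n) : Prop where
  init_x : x 0 ∈ X
  init_y : y 0 ∈ Y
  step_x : ∀ t, IsProjOnto X (x t - c • gradX (surrogate f rx ry (z t)) (x t) (y t)) (x (t + 1))
  step_y : ∀ t,
    IsProjOnto Y (y t + α • gradY (surrogate f rx ry (z t)) (x (t + 1)) (y t)) (y (t + 1))
  step_z : ∀ t, z (t + 1) = z t + β • (x (t + 1) - z t)

/-- The constant `ω` in the step-size condition. -/
noncomputable def omegaConst (ℓ rx ry α : ℝ) : ℝ :=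
  1 / √(2 * ry) *
    (((rx - ℓ) + α * ℓ * (3 * rx - 2 * ℓ)) / (α * (rx - ℓ) ^ (3 / 2 : ℝ)))

/-- The step-size condition for Perturbed Smoothed GDA, where every `Θ(·)` in it
has the constants `m` and `M`. -/
structure StepSizeCondition (m M ℓ rx ry c α β : ℝ) : Prop where
  ry_pos : 0 < ry
  rx_theta : IsThetaWith m M rx ℓ
  rx_gt : 3 * ℓ < rx
  α_theta : IsThetaWith m M α (1 / ℓ)
  α_pos : 0 < α
  α_le : α ≤ min (1 / (11 * ℓ))
    (c ^ 2 * (rx - ℓ) ^ 2 / (4 * ℓ * (1 + c * (rx - ℓ)) ^ 2))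
  c_theta : IsThetaWith m M c (1 / ℓ)
  c_pos : 0 < c
  c_lt : c < 1 / (rx + ℓ)
  β_pos : 0 < β
  β_le : β ≤ min (1 / 36) ((rx - ℓ) ^ 2 / (384 * rx * (rx + ℓ) ^ 2))
  β_theta : IsThetaWith m M β (ry / ℓ)
  β_le_omega : β ≤ 1 / (384 * rx * α * omegaConst ℓ rx ry α ^ 2)

/-! Write `F` for the surrogate, `d(y,z) = min_x F` and `P(z) = min_x max_y F`, so that the
potential is `F - 2d + 2P = (F - d) + (P - d) + P`. The brackets are nonnegative and `P` dominates
the perturbed minimax value, which bounds the potential below (`iInf_iSup_pertObj_le_potential`).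

The core is `potential_descent`: each iteration lowers the potential by at least `ℓ (‖x⁺ - x‖² + ‖y⁺
- y‖² + β ‖x⁺ - z‖²)`. The `x` step lowers `F`, the `y` step raises `d` because `x⁺` is close to the
exact minimizer (`projGrad_error_bound`, `dual_ascent`), and moving `z` gains a multiple of `β ‖x⁺ -
z‖²`. The harmful term is the distance between the saddle point in `x` and the current minimizer.
`dual_error_bound` controls it by `ω` times an idealized dual step, using the `r_y`-strong concavity
supplied by the perturbation; the bound on `β` in terms of `ω` lets the decrease absorb it.

Hence for any `δ > 0` some index at most `Δ/δ` has movement at most `δ` (`exists_small_step`).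
Optimality of the projections turns movement into residuals: the primal one is `O(ℓ · movement)`,
the dual one `O(ℓ ‖y⁺ - y‖) + r_y D`. Since `β` is of order `r_y/ℓ`, controlling `‖x⁺ - z‖` to
accuracy `ε/ℓ` requires `δ` of order `r_y (ε/ℓ)²`. Taking `r_y` of order `ε/D` gives the first rate.

For optimization stationarity, weak convexity of the primal function bounds the squared prox
distance by (dual residual)·`D` plus (primal residual)·(prox distance), in `prox_sq_le`. The bias
`r_y D²` must then be of order `ε²/ℓ`, which gives the second rate. -/

open Filter Topology Set

/-! ### Quadratic models and first-order conditions on convex sets -/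

section General

variable {E : Type*} [NormedAddCommGroup E] [InnerProductSpace ℝ E]

/-- If `a * s ≤ b * s ^ 2` for all small positive `s`, then `a ≤ 0`. -/
lemma nonpos_of_forall_mul_le {a b : ℝ}
    (h : ∀ s : ℝ, 0 < s → s ≤ 1 → a * s ≤ b * s ^ 2) : a ≤ 0 := by
  have h1 : ∀ᶠ s : ℝ in 𝓝[>] 0, a ≤ b * s := by
    filter_upwards [Ioc_mem_nhdsGT (zero_lt_one (α := ℝ))] with s hs
    have := h s hs.1 hs.2
    nlinarith [hs.1]
  have h2 : Tendsto (fun s : ℝ => b * s) (𝓝[>] 0) (𝓝 0) := by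
    have : Tendsto (fun s : ℝ => b * s) (𝓝 0) (𝓝 (b * 0)) := by
      exact (continuous_const.mul continuous_id).tendsto 0
    rw [mul_zero] at this
    exact this.mono_left nhdsWithin_le_nhds
  exact ge_of_tendsto h2 h1

lemma convex_segment_mem {K : Set E} (hK : Convex ℝ K) {x u : E} (hx : x ∈ K) (hu : u ∈ K)
    {s : ℝ} (h0 : 0 ≤ s) (h1 : s ≤ 1) : x + s • (u - x) ∈ K :=
  hK.add_smul_sub_mem hx hu ⟨h0, h1⟩

/-- First-order optimality on a convex set from a quadratic upper model. -/
lemma inner_nonneg_of_isMinOn {h : E → ℝ} {g p : E} {K : Set E} {L : ℝ} (hK : Convex ℝ K)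
    (hp : p ∈ K) (hmin : IsMinOn h K p)
    (hup : ∀ u ∈ K, h u ≤ h p + inner ℝ g (u - p) + L * ‖u - p‖ ^ 2) {u : E} (hu : u ∈ K) :
    0 ≤ inner ℝ g (u - p) := by
  have := nonpos_of_forall_mul_le (a := - inner ℝ g (u - p)) (b := L * ‖u - p‖ ^ 2) (by
    intro s h0 h1
    have hm := convex_segment_mem hK hp hu h0.le h1
    have h2 := hup _ hm
    have h3 : h p ≤ _ := hmin hm
    rw [add_sub_cancel_left, inner_smul_right, norm_smul, mul_pow, Real.norm_of_nonneg h0.le] at h2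
    nlinarith)
  linarith

variable [CompleteSpace E]

lemma HasGradientAt.hasDerivAt_line {h : E → ℝ} {g : E → E} (hg : ∀ x, HasGradientAt h (g x) x)
    (x v : E) (s : ℝ) :
    HasDerivAt (fun s : ℝ => h (x + s • v)) (inner ℝ (g (x + s • v)) v) s := by
  have h1 := (hg (x + s • v)).hasFDerivAt
  have h2 : HasDerivAt (fun s : ℝ => x + s • v) v s := by
    simpa using ((hasDerivAt_id s).smul_const v).const_add x
  have h3 := h1.comp_hasDerivAt s h2
  rw [InnerProductSpace.toDual_apply_apply] at h3
  exact h3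

/-- The descent inequality for a function whose gradient is Lipschitz on a convex set. -/
lemma le_add_inner_add_sq_of_lipschitz_gradient {h : E → ℝ} {g : E → E} {K : Set E} {L : ℝ}
    (hg : ∀ x, HasGradientAt h (g x) x) (hK : Convex ℝ K)
    (hL : ∀ x ∈ K, ∀ u ∈ K, ‖g x - g u‖ ≤ L * ‖x - u‖) {x u : E} (hx : x ∈ K) (hu : u ∈ K) :
    h u ≤ h x + inner ℝ (g x) (u - x) + L / 2 * ‖u - x‖ ^ 2 := by
  set v := u - x with hv
  -- The gap between `h` and its quadratic model along the segment; the Lipschitz bound makes its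
  -- derivative nonpositive.
  let φ : ℝ → ℝ := fun s => h (x + s • v) - s * inner ℝ (g x) v - L / 2 * s ^ 2 * ‖v‖ ^ 2
  have hφ : ∀ s, HasDerivAt φ
      (inner ℝ (g (x + s • v)) v - inner ℝ (g x) v - L * s * ‖v‖ ^ 2) s := by
    intro s
    have h1 := HasGradientAt.hasDerivAt_line hg x v s
    have h2 := (hasDerivAt_id s).mul_const (inner ℝ (g x) v)
    have h3 := (((hasDerivAt_pow 2 s).const_mul (L / 2)).mul_const (‖v‖ ^ 2))
    refine ((h1.sub h2).sub h3).congr_deriv ?_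
    push_cast
    ring
  have hanti : AntitoneOn φ (Icc 0 1) := by
    apply antitoneOn_of_deriv_nonpos (convex_Icc 0 1)
    · exact fun s _ => (hφ s).continuousAt.continuousWithinAt
    · exact fun s _ => (hφ s).differentiableAt.differentiableWithinAt
    · intro s hs
      rw [interior_Icc] at hs
      rw [(hφ s).deriv, ← inner_sub_left]
      have hmem := convex_segment_mem hK hx hu hs.1.le hs.2.le
      have h1 := hL _ hmem x hx
      have h2 := real_inner_le_norm (g (x + s • v) - g x) v
      have h3 : ‖x + s • v - x‖ = s * ‖v‖ := by
        rw [add_sub_cancel_left, norm_smul, Real.norm_of_nonneg hs.1.le]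
      rw [h3] at h1
      nlinarith [norm_nonneg v]
  have := hanti (left_mem_Icc.2 zero_le_one) (right_mem_Icc.2 zero_le_one) zero_le_one
  simp only [φ, hv] at this
  simp at this
  linarith

lemma add_inner_sub_sq_le_of_lipschitz_gradient {h : E → ℝ} {g : E → E} {K : Set E} {L : ℝ}
    (hg : ∀ x, HasGradientAt h (g x) x) (hK : Convex ℝ K)
    (hL : ∀ x ∈ K, ∀ u ∈ K, ‖g x - g u‖ ≤ L * ‖x - u‖) {x u : E} (hx : x ∈ K) (hu : u ∈ K) :
    h x + inner ℝ (g x) (u - x) - L / 2 * ‖u - x‖ ^ 2 ≤ h u := by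
  have := le_add_inner_add_sq_of_lipschitz_gradient (h := fun x => - h x) (g := fun x => - g x)
    (K := K) (L := L)
    (fun x => by rw [hasGradientAt_iff_hasFDerivAt, map_neg]; exact (hg x).hasFDerivAt.neg)
    hK (fun x hx u hu => by
      have := hL x hx u hu
      rwa [← norm_neg, neg_sub_neg, neg_sub]) hx hu
  rw [inner_neg_left] at this
  linarith

/-- The gradient inequality for concave functions. -/
lemma ConcaveOn.le_add_inner_gradient {h : E → ℝ} {g : E → E} {K : Set E}
    (hc : ConcaveOn ℝ K h) (hg : ∀ x, HasGradientAt h (g x) x) {x u : E} (hx : x ∈ K)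
    (hu : u ∈ K) : h u ≤ h x + inner ℝ (g x) (u - x) := by
  have h1 := HasGradientAt.hasDerivAt_line hg x (u - x) 0
  simp only [zero_smul, add_zero] at h1
  have h2 := h1.tendsto_slope_zero_right
  have h3 : ∀ᶠ s : ℝ in 𝓝[>] 0,
      h u - h x ≤ s⁻¹ • (h (x + (0 + s) • (u - x)) - h (x + (0 : ℝ) • (u - x))) := by
    filter_upwards [Ioc_mem_nhdsGT (zero_lt_one (α := ℝ))] with s hs
    have h4 := hc.2 hx hu (sub_nonneg.2 hs.2) hs.1.le (by ring)
    have h5 : (1 - s) • x + s • u = x + s • (u - x) := by module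
    rw [h5] at h4
    simp only [smul_eq_mul, zero_add, zero_smul, add_zero] at h4 ⊢
    rw [inv_mul_eq_div, le_div_iff₀ hs.1]
    nlinarith
  have := ge_of_tendsto h2 h3
  linarith

end General

/-! ### Projections and existence of minimizers -/

section Projection

variable {n : ℕ} {K : Set (RVec n)} {u u' p p' : RVec n}

lemma IsProjOnto.inner_le_zero (hK : Convex ℝ K) (h : IsProjOnto K u p) {w : RVec n}
    (hw : w ∈ K) : inner ℝ (u - p) (w - p) ≤ 0 := by
  refine (norm_eq_iInf_iff_real_inner_le_zero hK h.1).1 ?_ w hw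
  refine ((IsMinOn.iInf_eq (f := fun w => ‖u - w‖) h.1 ?_)).symm
  intro w hw
  have := h.2 w hw
  rwa [norm_sub_rev, norm_sub_rev w] at this

lemma IsProjOnto.norm_sub_le (hK : Convex ℝ K) (h : IsProjOnto K u p) (h' : IsProjOnto K u' p') :
    ‖p - p'‖ ≤ ‖u - u'‖ := by
  have h1 := h.inner_le_zero hK h'.1
  have h2 := h'.inner_le_zero hK h.1
  have h3 : ‖p - p'‖ ^ 2 ≤ inner ℝ (u - u') (p - p') := by
    rw [← real_inner_self_eq_norm_sq]
    have e1 : inner ℝ (u - p) (p' - p) = - inner ℝ (u - p) (p - p') := by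
      rw [← inner_neg_right, neg_sub]
    rw [e1] at h1
    have : inner ℝ (u - p) (p - p') - inner ℝ (u' - p') (p - p')
        = inner ℝ (u - u') (p - p') - inner ℝ (p - p') (p - p') := by
      rw [← inner_sub_left, ← inner_sub_left]; congr 1; abel
    linarith
  have h4 := real_inner_le_norm (u - u') (p - p')
  by_contra! h5
  nlinarith [norm_nonneg (u - u')]

lemma exists_isProjOnto (hK : IsCompact K) (hne : K.Nonempty) (u : RVec n) :
    ∃ p, IsProjOnto K u p := by
  obtain ⟨p, hp, hmin⟩ := hK.exists_isMinOn hne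
    (f := fun w => ‖w - u‖) (by fun_prop)
  exact ⟨p, hp, fun w hw => hmin hw⟩

/-- A continuous function on a closed set that exceeds one of its values outside a ball attains
its minimum. -/
lemma exists_isMinOn_of_le_of_lt_norm {h : RVec n → ℝ} {x₀ : RVec n} {R : ℝ} (hK : IsClosed K)
    (hx₀ : x₀ ∈ K) (hh : Continuous h) (hR : ∀ w ∈ K, R < ‖w - x₀‖ → h x₀ ≤ h w) :
    ∃ p ∈ K, IsMinOn h K p := by
  refine hh.continuousOn.exists_isMinOn' hK hx₀ ?_
  rw [Filter.eventually_inf_principal]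
  filter_upwards [(isCompact_closedBall x₀ R).compl_mem_cocompact] with w hw hwK
  refine hR w hwK ?_
  simpa [dist_eq_norm] using hw

end Projection

/-- If a sequence is bounded below and its decrements dominate `s t`, then some early `s t` is at
most `δ`. -/
lemma exists_le_of_descent {Ψ s : ℕ → ℝ} {B δ : ℝ} (hδ : 0 < δ) (hB : ∀ t, B ≤ Ψ t)
    (hs : ∀ t, s t ≤ Ψ t - Ψ (t + 1)) : ∃ t : ℕ, (t : ℝ) ≤ (Ψ 0 - B) / δ ∧ s t ≤ δ := by
  by_contra! hcon
  have h0 : 0 ≤ (Ψ 0 - B) / δ := div_nonneg (sub_nonneg.2 (hB 0)) hδ.le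
  -- If all indices `0, ..., T` fail, `T + 1` decrements exceed `δ`, and `(T + 1) δ > Ψ 0 - B`
  -- crosses the lower bound.
  set T := ⌊(Ψ 0 - B) / δ⌋₊ with hT
  have key : ∀ k : ℕ, k ≤ T + 1 → Ψ k ≤ Ψ 0 - k * δ := by
    intro k
    induction k with
    | zero => intro _; simp
    | succ k ih =>
      intro hk
      have h1 := ih (by omega)
      have h2 := hs k
      have h3 : δ < s k := hcon k ((Nat.le_floor_iff h0).1 (by omega))
      push_cast
      linarith
  have h1 := key (T + 1) le_rfl
  have h2 := hB (T + 1)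
  have h3 := Nat.lt_floor_add_one ((Ψ 0 - B) / δ)
  rw [← hT, div_lt_iff₀ hδ] at h3
  push_cast at h1
  linarith

lemma norm_sub_sq_expand {E : Type*} [NormedAddCommGroup E] [InnerProductSpace ℝ E] (u x z : E) :
    ‖u - z‖ ^ 2 = ‖x - z‖ ^ 2 + 2 * inner ℝ (x - z) (u - x) + ‖u - x‖ ^ 2 := by
  rw [← norm_add_sq_real]; congr 2; abel

/-! ### The surrogate: curvature, error bounds and saddle points -/

section Surrogate

/-- The `x`-gradient of the surrogate. -/
noncomputable def surrogateGradX {n d : ℕ} (f : RVec n → RVec d → ℝ) (rx : ℝ) (z x : RVec n)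
    (y : RVec d) : RVec n := gradX f x y + rx • (x - z)

/-- The `y`-gradient of the surrogate. -/
noncomputable def surrogateGradY {n d : ℕ} (f : RVec n → RVec d → ℝ) (ry : ℝ) (x : RVec n)
    (y : RVec d) : RVec d := gradY f x y - ry • y

variable {n d : ℕ} {X : Set (RVec n)} {Y : Set (RVec d)} {f : RVec n → RVec d → ℝ}
  {ℓ rx ry : ℝ} {z z' x u p p' : RVec n} {y v y' : RVec d}

lemma IsSmoothOn.differentiable (h : IsSmoothOn X Y f ℓ) :
    Differentiable ℝ (fun p : RVec n × RVec d => f p.1 p.2) :=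
  h.contDiff.differentiable one_ne_zero

lemma IsSmoothOn.hasGradientAt_left (h : IsSmoothOn X Y f ℓ) (x : RVec n) (y : RVec d) :
    HasGradientAt (fun x' => f x' y) (gradX f x y) x := by
  have h1 : Differentiable ℝ (fun x' : RVec n => f x' y) :=
    h.differentiable.comp (differentiable_id.prodMk (differentiable_const y))
  exact (h1 x).hasGradientAt

lemma IsSmoothOn.hasGradientAt_right (h : IsSmoothOn X Y f ℓ) (x : RVec n) (y : RVec d) :
    HasGradientAt (fun y' => f x y') (gradY f x y) y := by
  have h1 : Differentiable ℝ (fun y' : RVec d => f x y') :=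
    h.differentiable.comp ((differentiable_const x).prodMk differentiable_id)
  exact (h1 y).hasGradientAt

lemma hasGradientAt_half_mul_norm_sub_sq (r : ℝ) (z x : RVec n) :
    HasGradientAt (fun w => r / 2 * ‖w - z‖ ^ 2) (r • (x - z)) x := by
  rw [hasGradientAt_iff_hasFDerivAt]
  have h1 : HasFDerivAt (fun w : RVec n => w - z) (ContinuousLinearMap.id ℝ (RVec n)) x :=
    (hasFDerivAt_id x).sub_const z
  refine (h1.norm_sq.const_mul (r / 2)).congr_fderiv ?_
  ext w
  simp
  ring

lemma gradX_surrogate (h : IsSmoothOn X Y f ℓ) :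
    gradX (surrogate f rx ry z) x y = surrogateGradX f rx z x y := by
  refine HasGradientAt.gradient ?_
  have h1 := (h.hasGradientAt_left x y).hasFDerivAt
  have h2 := (hasGradientAt_half_mul_norm_sub_sq rx z x).hasFDerivAt
  rw [hasGradientAt_iff_hasFDerivAt, surrogateGradX, map_add]
  exact (h1.add h2).sub_const _

lemma gradY_surrogate (h : IsSmoothOn X Y f ℓ) :
    gradY (surrogate f rx ry z) x y = surrogateGradY f ry x y := by
  refine HasGradientAt.gradient ?_
  have h1 := (h.hasGradientAt_right x y).hasFDerivAt
  have h2 := (hasGradientAt_half_mul_norm_sub_sq ry 0 y).hasFDerivAt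
  rw [hasGradientAt_iff_hasFDerivAt, surrogateGradY, map_sub]
  simp only [sub_zero] at h2
  exact (h1.add_const _).sub h2

lemma IsSmoothOn.continuous (h : IsSmoothOn X Y f ℓ) :
    Continuous (fun p : RVec n × RVec d => f p.1 p.2) := h.contDiff.continuous

lemma IsSmoothOn.continuous_surrogate (h : IsSmoothOn X Y f ℓ) (rx ry : ℝ) (z : RVec n) :
    Continuous (fun p : RVec n × RVec d => surrogate f rx ry z p.1 p.2) := by
  have := h.continuous
  unfold surrogate
  fun_prop

lemma IsSmoothOn.continuous_surrogate_left (h : IsSmoothOn X Y f ℓ) (rx ry : ℝ) (z : RVec n)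
    (y : RVec d) : Continuous (fun u => surrogate f rx ry z u y) :=
  (h.continuous_surrogate rx ry z).comp (by fun_prop : Continuous fun u : RVec n => (u, y))

lemma IsSmoothOn.continuous_surrogate_right (h : IsSmoothOn X Y f ℓ) (rx ry : ℝ) (z x : RVec n) :
    Continuous (fun v => surrogate f rx ry z x v) :=
  (h.continuous_surrogate rx ry z).comp (by fun_prop : Continuous fun v : RVec d => (x, v))

lemma IsSmoothOn.lipX_left (h : IsSmoothOn X Y f ℓ) (hy : y ∈ Y) :
    ∀ x ∈ X, ∀ u ∈ X, ‖gradX f x y - gradX f u y‖ ≤ ℓ * ‖x - u‖ := fun x hx u hu => by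
  simpa using h.lipX x hx u hu y hy y hy

lemma IsSmoothOn.lipY_right (h : IsSmoothOn X Y f ℓ) (hx : x ∈ X) :
    ∀ y ∈ Y, ∀ v ∈ Y, ‖gradY f x y - gradY f x v‖ ≤ ℓ * ‖y - v‖ := fun y hy v hv => by
  simpa using h.lipY x hx x hx y hy v hv

variable (hP : IsNCCProblem X Y f ℓ)

include hP

/-- Smoothness costs at most curvature `ℓ`, while the proximal term contributes exactly `rx`; for
`rx > ℓ` this is strong convexity in `x`. -/
lemma surrogate_left_ge (hx : x ∈ X) (hu : u ∈ X) (hy : y ∈ Y) :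
    surrogate f rx ry z x y + inner ℝ (surrogateGradX f rx z x y) (u - x)
      + (rx - ℓ) / 2 * ‖u - x‖ ^ 2 ≤ surrogate f rx ry z u y := by
  have h1 := add_inner_sub_sq_le_of_lipschitz_gradient
    (fun w => hP.smooth.hasGradientAt_left w y) hP.convex_X (hP.smooth.lipX_left hy) hx hu
  simp only [surrogate, surrogateGradX, inner_add_left, inner_smul_left, norm_sub_sq_expand u x z]
  simp only [conj_trivial]
  linarith

lemma surrogate_left_le (hx : x ∈ X) (hu : u ∈ X) (hy : y ∈ Y) :
    surrogate f rx ry z u y ≤ surrogate f rx ry z x y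
      + inner ℝ (surrogateGradX f rx z x y) (u - x) + (rx + ℓ) / 2 * ‖u - x‖ ^ 2 := by
  have h1 := le_add_inner_add_sq_of_lipschitz_gradient
    (fun w => hP.smooth.hasGradientAt_left w y) hP.convex_X (hP.smooth.lipX_left hy) hx hu
  simp only [surrogate, surrogateGradX, inner_add_left, inner_smul_left, norm_sub_sq_expand u x z]
  simp only [conj_trivial]
  linarith

lemma surrogate_right_ge (hx : x ∈ X) (hy : y ∈ Y) (hv : v ∈ Y) :
    surrogate f rx ry z x y + inner ℝ (surrogateGradY f ry x y) (v - y)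
      - (ℓ + ry) / 2 * ‖v - y‖ ^ 2 ≤ surrogate f rx ry z x v := by
  have h1 := add_inner_sub_sq_le_of_lipschitz_gradient
    (fun w => hP.smooth.hasGradientAt_right x w) hP.convex_Y (hP.smooth.lipY_right hx) hy hv
  have h2 := norm_sub_sq_expand v y 0
  simp only [sub_zero] at h2
  simp only [surrogate, surrogateGradY, inner_sub_left, inner_smul_left, h2]
  simp only [conj_trivial]
  linarith

/-- Concavity of `f` leaves no positive curvature, so the perturbation alone supplies strong
concavity with modulus `ry`. -/
lemma surrogate_right_le (hx : x ∈ X) (hy : y ∈ Y) (hv : v ∈ Y) :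
    surrogate f rx ry z x v ≤ surrogate f rx ry z x y
      + inner ℝ (surrogateGradY f ry x y) (v - y) - ry / 2 * ‖v - y‖ ^ 2 := by
  have h1 := (hP.concave x hx).le_add_inner_gradient
    (fun w => hP.smooth.hasGradientAt_right x w) hy hv
  have h2 := norm_sub_sq_expand v y 0
  simp only [sub_zero] at h2
  simp only [surrogate, surrogateGradY, inner_sub_left, inner_smul_left, h2]
  simp only [conj_trivial]
  linarith

/-- The surrogate attains its minimum in `x`. -/
lemma exists_isMinOn_surrogate (hrx : ℓ < rx) (hx : x ∈ X) (hy : y ∈ Y) (z : RVec n) :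
    ∃ p ∈ X, IsMinOn (fun u => surrogate f rx ry z u y) X p := by
  refine exists_isMinOn_of_le_of_lt_norm (R := 2 * ‖surrogateGradX f rx z x y‖ / (rx - ℓ))
    hP.closed_X hx (hP.smooth.continuous_surrogate_left rx ry z y) ?_
  intro w hw hR
  have h1 := surrogate_left_ge hP (rx := rx) (ry := ry) (z := z) hx hw hy
  have h2 := neg_le_of_abs_le (abs_real_inner_le_norm (surrogateGradX f rx z x y) (w - x))
  rw [div_lt_iff₀ (sub_pos.2 hrx)] at hR
  nlinarith [norm_nonneg (w - x)]

lemma surrogateGradX_inner_nonneg (hy : y ∈ Y) (hp : p ∈ X)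
    (hmin : IsMinOn (fun u => surrogate f rx ry z u y) X p) (hu : u ∈ X) :
    0 ≤ inner ℝ (surrogateGradX f rx z p y) (u - p) :=
  inner_nonneg_of_isMinOn hP.convex_X hp hmin
    (fun _ hw => surrogate_left_le hP hp hw hy) hu

/-- Quadratic growth of the surrogate around its minimizer in `x`. -/
lemma surrogate_growth (hy : y ∈ Y) (hp : p ∈ X)
    (hmin : IsMinOn (fun u => surrogate f rx ry z u y) X p) (hu : u ∈ X) :
    surrogate f rx ry z p y + (rx - ℓ) / 2 * ‖u - p‖ ^ 2 ≤ surrogate f rx ry z u y := by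
  have h1 := surrogate_left_ge hP (rx := rx) (ry := ry) (z := z) hp hu hy
  have h2 := surrogateGradX_inner_nonneg hP hy hp hmin hu
  linarith

/-- Lipschitz dependence of the minimizer in `x` on `y` and `z`. -/
lemma minimizer_lipschitz (hrx : ℓ < rx) (hy : y ∈ Y) (hy' : y' ∈ Y) (hp : p ∈ X) (hp' : p' ∈ X)
    (hmin : IsMinOn (fun u => surrogate f rx ry z u y) X p)
    (hmin' : IsMinOn (fun u => surrogate f rx ry z' u y') X p') :
    (rx - ℓ) * ‖p - p'‖ ≤ ℓ * ‖y - y'‖ + rx * ‖z - z'‖ := by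
  have h1 := surrogateGradX_inner_nonneg hP hy hp hmin hp'
  have h2 := surrogateGradX_inner_nonneg hP hy' hp' hmin' hp
  have h3 := hP.smooth.lipX p hp p' hp' y hy y' hy'
  have hℓ := hP.smooth.pos
  have e1 : inner ℝ (surrogateGradX f rx z p y) (p' - p)
      = - inner ℝ (surrogateGradX f rx z p y) (p - p') := by
    rw [← inner_neg_right, neg_sub]
  -- The two variational inequalities add up to a bound on `rx ‖p - p'‖²`; one factor `‖p - p'‖` is
  -- cancelled at the end.
  have e2 : inner ℝ (surrogateGradX f rx z' p' y') (p - p')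
      - inner ℝ (surrogateGradX f rx z p y) (p - p')
      = - inner ℝ (gradX f p y - gradX f p' y') (p - p') - rx * ‖p - p'‖ ^ 2
        + rx * inner ℝ (z - z') (p - p') := by
    rw [← real_inner_self_eq_norm_sq, ← inner_sub_left, ← inner_neg_left,
      ← real_inner_smul_left, ← real_inner_smul_left, ← inner_sub_left, ← inner_add_left]
    congr 1
    simp only [surrogateGradX]
    module
  have h4 := neg_le_of_abs_le (abs_real_inner_le_norm (gradX f p y - gradX f p' y') (p - p'))
  have h5 := real_inner_le_norm (z - z') (p - p')
  have h6 : rx * ‖p - p'‖ ^ 2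
      ≤ (ℓ * (‖p - p'‖ + ‖y - y'‖) + rx * ‖z - z'‖) * ‖p - p'‖ := by
    have := mul_le_mul_of_nonneg_right h3 (norm_nonneg (p - p'))
    have := mul_le_mul_of_nonneg_left h5 (hℓ.trans hrx).le
    nlinarith
  by_contra! h7
  have h8 : 0 < ‖p - p'‖ := by
    rcases (norm_nonneg (p - p')).eq_or_lt with h0 | h0
    · rw [← h0] at h7
      have : 0 ≤ ℓ * ‖y - y'‖ + rx * ‖z - z'‖ := by
        have := hℓ.trans hrx
        positivity
      linarith
    · exact h0
  nlinarith

/-- One projected gradient step in `x`: sufficient decrease. -/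
lemma surrogate_projGrad_le {c : ℝ} (hc : 0 < c) (hc' : c * (rx + ℓ) < 1) (hx : x ∈ X) (hy : y ∈ Y)
    (hu : IsProjOnto X (x - c • surrogateGradX f rx z x y) u) :
    surrogate f rx ry z u y + 1 / (2 * c) * ‖u - x‖ ^ 2 ≤ surrogate f rx ry z x y := by
  have h1 := surrogate_left_le hP (rx := rx) (ry := ry) (z := z) hx hu.1 hy
  have h2 := hu.inner_le_zero hP.convex_X hx
  have e : inner ℝ (x - c • surrogateGradX f rx z x y - u) (x - u)
      = ‖u - x‖ ^ 2 + c * inner ℝ (surrogateGradX f rx z x y) (u - x) := by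
    rw [norm_sub_rev, ← real_inner_self_eq_norm_sq, ← real_inner_smul_left, ← neg_sub x u,
      inner_neg_right, ← sub_eq_add_neg, ← inner_sub_left]
    congr 1; abel
  rw [e] at h2
  have h3 : inner ℝ (surrogateGradX f rx z x y) (u - x) ≤ - (1 / c) * ‖u - x‖ ^ 2 := by
    rw [neg_mul, le_neg, div_mul_eq_mul_div, one_mul, div_le_iff₀ hc]
    linarith
  have h4 : (rx + ℓ) ≤ 1 / c := by rw [le_div_iff₀ hc]; linarith
  have h5 : 1 / (2 * c) = 1 / c / 2 := by field_simp
  rw [h5]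
  nlinarith [sq_nonneg ‖u - x‖]

/-- One projected gradient step in `x`: error bound. -/
lemma projGrad_error_bound {c : ℝ} (hc : 0 < c) (hrx : ℓ < rx) (hc' : c * (rx + ℓ) < 1)
    (hx : x ∈ X) (hy : y ∈ Y) (hp : p ∈ X)
    (hmin : IsMinOn (fun u => surrogate f rx ry z u y) X p)
    (hu : IsProjOnto X (x - c • surrogateGradX f rx z x y) u) :
    c * (rx - ℓ) * ‖u - p‖ ≤ ‖u - x‖ := by
  have h1 := surrogate_left_le hP (rx := rx) (ry := ry) (z := z) hx hu.1 hy
  have h2 := hu.inner_le_zero hP.convex_X hp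
  have h3 := surrogate_left_ge hP (rx := rx) (ry := ry) (z := z) hx hp hy
  have h4 := surrogate_growth hP hy hp hmin hu.1
  have e1 : inner ℝ (x - c • surrogateGradX f rx z x y - u) (p - u)
      = inner ℝ (x - u) (p - u) - c * inner ℝ (surrogateGradX f rx z x y) (p - u) := by
    rw [← real_inner_smul_left, ← inner_sub_left]
    congr 1; abel
  have e2 : inner ℝ (surrogateGradX f rx z x y) (p - x)
      = inner ℝ (surrogateGradX f rx z x y) (p - u)
        + inner ℝ (surrogateGradX f rx z x y) (u - x) := by
    rw [← inner_add_right]; congr 1; abel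
  have e3 : ‖p - x‖ ^ 2 = ‖u - x‖ ^ 2 + ‖u - p‖ ^ 2 - 2 * inner ℝ (x - u) (p - u) := by
    rw [norm_sub_sq_expand p u x, norm_sub_rev p u, ← neg_sub x u, inner_neg_left]
    ring
  have h5 : ‖p - x‖ ≤ ‖u - x‖ + ‖u - p‖ := by
    rw [norm_sub_rev u p, add_comm]; exact norm_sub_le_norm_sub_add_norm_sub p u x
  have hℓ := hP.smooth.pos
  rw [e1] at h2
  -- The step contracts towards `p`. Multiplying by `1 + k`, with `1 - k² ≤ 1`, gives `(1 + k) ‖u -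
  -- p‖ ≤ ‖p - x‖`, and the triangle inequality through `u` leaves `k ‖u - p‖ ≤ ‖u - x‖`.
  have h6 : (1 + c * (rx - ℓ)) * ‖u - p‖ ^ 2 ≤ (1 - c * (rx - ℓ)) * ‖p - x‖ ^ 2 := by
    have h7 : inner ℝ (surrogateGradX f rx z x y) (p - u) + (rx - ℓ) / 2 * ‖p - x‖ ^ 2
        + (rx - ℓ) / 2 * ‖u - p‖ ^ 2 - (rx + ℓ) / 2 * ‖u - x‖ ^ 2 ≤ 0 := by linarith
    have h8 := mul_le_mul_of_nonneg_left h7 hc.le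
    have h9 : 0 ≤ (1 - c * (rx + ℓ)) * ‖u - x‖ ^ 2 :=
      mul_nonneg (by linarith) (sq_nonneg _)
    nlinarith
  set k := c * (rx - ℓ) with hk
  have hk0 : 0 < k := mul_pos hc (by linarith)
  have h7 : ((1 + k) * ‖u - p‖) ^ 2 ≤ ‖p - x‖ ^ 2 := by
    have := mul_le_mul_of_nonneg_left h6 (by linarith : 0 ≤ 1 + k)
    nlinarith [mul_nonneg (sq_nonneg k) (sq_nonneg ‖p - x‖)]
  have h8 := (sq_le_sq₀ (by positivity) (norm_nonneg _)).1 h7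
  linarith

/-- Lower quadratic model of the dual function `y ↦ min_x F(x, y, z)`. -/
lemma dual_ascent (hrx : 3 * ℓ < rx) (hry : ry ≤ ℓ) (hy : y ∈ Y) (hy' : y' ∈ Y) (hp : p ∈ X)
    (hp' : p' ∈ X) (hmin : IsMinOn (fun u => surrogate f rx ry z u y) X p) :
    surrogate f rx ry z p y + inner ℝ (surrogateGradY f ry p y) (y' - y)
      - 5 / 4 * ℓ * ‖y' - y‖ ^ 2 ≤ surrogate f rx ry z p' y' := by
  have h1 := surrogate_right_ge hP (rx := rx) (ry := ry) (z := z) hp' hy hy'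
  have h2 := surrogate_growth hP hy hp hmin hp'
  have h3 := hP.smooth.lipY p' hp' p hp y hy y hy
  rw [sub_self, norm_zero, add_zero] at h3
  have e : inner ℝ (surrogateGradY f ry p' y) (y' - y)
      = inner ℝ (surrogateGradY f ry p y) (y' - y)
        + inner ℝ (gradY f p' y - gradY f p y) (y' - y) := by
    rw [← inner_add_left]; congr 1; simp only [surrogateGradY]; abel
  have h4 := neg_le_of_abs_le (abs_real_inner_le_norm (gradY f p' y - gradY f p y) (y' - y))
  have h5 := mul_le_mul_of_nonneg_right h3 (norm_nonneg (y' - y))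
  have hℓ := hP.smooth.pos
  have h6 : ℓ * ‖p' - p‖ ^ 2 ≤ (rx - ℓ) / 2 * ‖p' - p‖ ^ 2 :=
    mul_le_mul_of_nonneg_right (by linarith) (sq_nonneg _)
  have h7 : (ℓ + ry) / 2 * ‖y' - y‖ ^ 2 ≤ ℓ * ‖y' - y‖ ^ 2 :=
    mul_le_mul_of_nonneg_right (by linarith) (sq_nonneg _)
  -- Growth at `p` pays for the gradient mismatch: the cross term costs `ℓ ‖p' - p‖²` plus `ℓ/4 ‖y'
  -- - y‖²`, whence `5/4`. Minimality of `p'` is never needed.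
  have h8 := mul_nonneg hℓ.le (sq_nonneg (‖p' - p‖ - 1 / 2 * ‖y' - y‖))
  nlinarith

/-- A saddle point of the surrogate exists. -/
lemma exists_saddle (hrx : 3 * ℓ < rx) (hry0 : 0 ≤ ry) (hry : ry ≤ ℓ) (hx : x ∈ X) (z : RVec n) :
    ∃ p ∈ X, ∃ y ∈ Y, IsMinOn (fun u => surrogate f rx ry z u y) X p ∧
      IsMaxOn (fun v => surrogate f rx ry z p v) Y y := by
  have hℓ := hP.smooth.pos
  -- No minimax theorem is invoked: maximize the dual function, take the minimizer `p` there, and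
  -- use `dual_ascent` along segments to get first-order optimality of `y` for `F(p, ·)`, which
  -- concavity makes global.
  have hmin : ∀ v ∈ Y, ∃ p ∈ X, IsMinOn (fun u => surrogate f rx ry z u v) X p :=
    fun v hv => exists_isMinOn_surrogate hP (by linarith) hx hv z
  have husc : UpperSemicontinuousOn (fun v => ⨅ u : X, surrogate f rx ry z u v) Y := by
    refine upperSemicontinuousOn_ciInf ?_ ?_
    · intro v hv
      obtain ⟨p, hp, hm⟩ := hmin v hv
      exact ⟨surrogate f rx ry z p v, by rintro _ ⟨u, rfl⟩; exact hm u.2⟩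
    · intro u
      exact (hP.smooth.continuous_surrogate_right rx ry z u).continuousOn.upperSemicontinuousOn
  obtain ⟨y, hy, hmax⟩ := husc.exists_isMaxOn ⟨0, hP.zero_mem_Y⟩ hP.compact_Y
  obtain ⟨p, hp, hm⟩ := hmin y hy
  refine ⟨p, hp, y, hy, hm, ?_⟩
  have key : ∀ v ∈ Y, inner ℝ (surrogateGradY f ry p y) (v - y) ≤ 0 := by
    intro v hv
    refine nonpos_of_forall_mul_le (b := 5 / 4 * ℓ * ‖v - y‖ ^ 2) ?_
    intro s h0 h1
    have hvs := convex_segment_mem hP.convex_Y hy hv h0.le h1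
    obtain ⟨q, hq, hqm⟩ := hmin _ hvs
    have h2 := dual_ascent hP hrx hry hy hvs hp hq hm
    have h3 : (⨅ u : X, surrogate f rx ry z u (y + s • (v - y)))
      ≤ ⨅ u : X, surrogate f rx ry z u y := hmax hvs
    rw [hm.iInf_eq hp, hqm.iInf_eq hq] at h3
    rw [add_sub_cancel_left, inner_smul_right, norm_smul, mul_pow, Real.norm_of_nonneg h0.le] at h2
    nlinarith
  intro v hv
  have h1 := surrogate_right_le hP (rx := rx) (ry := ry) (z := z) hp hy hv
  have h2 := key v hv
  have h3 : 0 ≤ ry / 2 * ‖v - y‖ ^ 2 := by positivity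
  show surrogate f rx ry z p v ≤ surrogate f rx ry z p y
  linarith

lemma bddAbove_surrogate_right (rx ry : ℝ) (z x : RVec n) :
    BddAbove (range fun v : Y => surrogate f rx ry z x v) := by
  have := (hP.compact_Y.image (hP.smooth.continuous_surrogate_right rx ry z x)).bddAbove
  rwa [image_eq_range] at this

/-- The value `min_x max_y F(x, y, z)` at a saddle point. -/
lemma iInf_iSup_surrogate_eq (hp : p ∈ X) (hy : y ∈ Y)
    (hmin : IsMinOn (fun u => surrogate f rx ry z u y) X p)
    (hmax : IsMaxOn (fun v => surrogate f rx ry z p v) Y y) :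
    (⨅ u : X, ⨆ v : Y, surrogate f rx ry z u v) = surrogate f rx ry z p y := by
  have h1 : (⨆ v : Y, surrogate f rx ry z p v) = surrogate f rx ry z p y := hmax.iSup_eq hy
  have h2 : IsMinOn (fun u => ⨆ v : Y, surrogate f rx ry z u v) X p := by
    intro u hu
    show (⨆ v : Y, surrogate f rx ry z p v) ≤ ⨆ v : Y, surrogate f rx ry z u v
    rw [h1]
    exact (hmin hu).trans (le_ciSup (bddAbove_surrogate_right hP rx ry z u) ⟨y, hy⟩)
  rw [h2.iInf_eq hp, h1]

/-- The dual error bound. -/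
lemma dual_error_bound {α : ℝ} {ps q : RVec n} {ys yp : RVec d} (hα : 0 < α) (hrx : 3 * ℓ < rx)
    (hry0 : 0 < ry) (hry : ry ≤ ℓ) (hps : ps ∈ X) (hys : ys ∈ Y)
    (hsmin : IsMinOn (fun u => surrogate f rx ry z u ys) X ps)
    (hsmax : IsMaxOn (fun v => surrogate f rx ry z ps v) Y ys)
    (hy : y ∈ Y) (hp : p ∈ X) (hmin : IsMinOn (fun u => surrogate f rx ry z u y) X p)
    (hyp : IsProjOnto Y (y + α • surrogateGradY f ry p y) yp)
    (hq : q ∈ X) (hqmin : IsMinOn (fun u => surrogate f rx ry z u yp) X q) :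
    ‖ps - q‖ ≤ omegaConst ℓ rx ry α * ‖y - yp‖ := by
  have hℓ := hP.smooth.pos
  have hμ : 0 < rx - ℓ := by linarith
  set r := ‖ps - q‖ with hr
  set s := ‖ys - yp‖ with hs
  set g := ‖y - yp‖ with hg
  -- Adding `h1` to `h4` cancels all four function values and leaves `(rx - ℓ)/2 r² + ry s² ≤ ⟪∇_y
  -- F(q, yp), ys - yp⟫`; the rest bounds this inner product by `W g s`.
  have h1 : surrogate f rx ry z ps yp + ry / 2 * s ^ 2 ≤ surrogate f rx ry z ps ys := by
    have h0 := inner_nonneg_of_isMinOn (h := fun v => - surrogate f rx ry z ps v)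
      (g := - surrogateGradY f ry ps ys) (L := (ℓ + ry) / 2) hP.convex_Y hys
      hsmax.neg (fun v hv => by
        have := surrogate_right_ge hP (rx := rx) (ry := ry) (z := z) hps hys hv
        rw [inner_neg_left]; linarith) hyp.1
    rw [inner_neg_left] at h0
    have := surrogate_right_le hP (rx := rx) (ry := ry) (z := z) hps hys hyp.1
    rw [norm_sub_rev yp ys] at this
    linarith
  have h2 := surrogate_growth hP hyp.1 hq hqmin hps
  have h3 : surrogate f rx ry z ps ys ≤ surrogate f rx ry z q ys := hsmin hq
  have h4 := surrogate_right_le hP (rx := rx) (ry := ry) (z := z) hq hyp.1 hys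
  have h5 := hyp.inner_le_zero hP.convex_Y hys
  have h6 : inner ℝ (surrogateGradY f ry p y) (ys - yp) ≤ 1 / α * (g * s) := by
    have e : inner ℝ (y + α • surrogateGradY f ry p y - yp) (ys - yp)
        = inner ℝ (y - yp) (ys - yp) + α * inner ℝ (surrogateGradY f ry p y) (ys - yp) := by
      rw [← real_inner_smul_left, ← inner_add_left]; congr 1; abel
    rw [e] at h5
    have := neg_le_of_abs_le (abs_real_inner_le_norm (y - yp) (ys - yp))
    rw [div_mul_eq_mul_div, one_mul, le_div_iff₀ hα]
    linarith
  have h7 : (rx - ℓ) * ‖q - p‖ ≤ ℓ * g := by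
    have := minimizer_lipschitz hP (by linarith) hyp.1 hy hq hp hqmin hmin
    rwa [sub_self, norm_zero, mul_zero, add_zero, norm_sub_rev yp] at this
  have h8 : inner ℝ (surrogateGradY f ry q yp) (ys - yp)
      ≤ inner ℝ (surrogateGradY f ry p y) (ys - yp) + (ℓ * (‖q - p‖ + g) + ry * g) * s := by
    have e : inner ℝ (surrogateGradY f ry q yp) (ys - yp)
        = inner ℝ (surrogateGradY f ry p y) (ys - yp)
          + inner ℝ (gradY f q yp - gradY f p y + ry • (y - yp)) (ys - yp) := by
      rw [← inner_add_left]; congr 1; simp only [surrogateGradY]; module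
    rw [e]
    have h9 := real_inner_le_norm (gradY f q yp - gradY f p y + ry • (y - yp)) (ys - yp)
    have h10 : ‖gradY f q yp - gradY f p y + ry • (y - yp)‖ ≤ ℓ * (‖q - p‖ + g) + ry * g := by
      refine (norm_add_le _ _).trans (add_le_add ?_ ?_)
      · have := hP.smooth.lipY q hq p hp yp hyp.1 y hy
        rwa [norm_sub_rev yp y] at this
      · rw [norm_smul, Real.norm_of_nonneg hry0.le]
    have := mul_le_mul_of_nonneg_right h10 (norm_nonneg (ys - yp))
    linarith
  have hr0 : 0 ≤ r := norm_nonneg _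
  have hs0 : 0 ≤ s := norm_nonneg _
  have hg0 : 0 ≤ g := norm_nonneg _
  -- The second summand equals `ℓ²/(rx - ℓ) + 3ℓ`, of which `ℓ²/(rx - ℓ) + ℓ + ry` is used.
  set W := 1 / α + ℓ * (3 * rx - 2 * ℓ) / (rx - ℓ) with hW
  have hWpos : 0 ≤ W := by
    have : 0 < 3 * rx - 2 * ℓ := by linarith
    positivity
  have h9 : (rx - ℓ) / 2 * r ^ 2 + ry * s ^ 2 ≤ W * g * s := by
    have h10 : ℓ * (‖q - p‖ + g) + ry * g ≤ ℓ * (3 * rx - 2 * ℓ) / (rx - ℓ) * g := by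
      have h11 : ‖q - p‖ ≤ ℓ * g / (rx - ℓ) := by rw [le_div_iff₀ hμ]; linarith
      have h12 : ℓ * (3 * rx - 2 * ℓ) / (rx - ℓ) * g
          = ℓ * (ℓ * g / (rx - ℓ)) + 3 * ℓ * g := by field_simp; ring
      rw [h12]
      nlinarith
    have := mul_le_mul_of_nonneg_right h10 hs0
    have : W * g * s = 1 / α * (g * s) + ℓ * (3 * rx - 2 * ℓ) / (rx - ℓ) * g * s := by
      rw [hW]; ring
    linarith
  have h10 : 2 * ry * (rx - ℓ) * r ^ 2 ≤ (W * g) ^ 2 := by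
    -- Completing the square eliminates `s`, the unknown distance to the dual solution.
    nlinarith [sq_nonneg (W * g - 2 * ry * s)]
  have hω : 0 ≤ omegaConst ℓ rx ry α := by
    unfold omegaConst
    have : 0 ≤ 3 * rx - 2 * ℓ := by linarith
    positivity
  have hω2 : omegaConst ℓ rx ry α ^ 2 * (2 * ry * (rx - ℓ)) = W ^ 2 := by
    unfold omegaConst
    have e1 : ((rx - ℓ) ^ (3 / 2 : ℝ)) ^ 2 = (rx - ℓ) ^ 3 := by
      rw [← Real.rpow_natCast, ← Real.rpow_mul hμ.le, ← Real.rpow_natCast]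
      norm_num
    rw [mul_pow, div_pow, div_pow, mul_pow, e1, Real.sq_sqrt (by positivity), hW]
    field_simp
  refine (sq_le_sq₀ hr0 (by positivity)).1 ?_
  have h11 : 0 < 2 * ry * (rx - ℓ) := by positivity
  refine le_of_mul_le_mul_left ?_ h11
  calc 2 * ry * (rx - ℓ) * r ^ 2 ≤ (W * g) ^ 2 := h10
    _ = 2 * ry * (rx - ℓ) * (omegaConst ℓ rx ry α * g) ^ 2 := by
      rw [mul_pow, ← hω2]; ring

end Surrogate

/-! ### Sufficient decrease of the potential -/

section Descent

/-- The correction is affine in `u` and free of `v`, so the changes of `d` and `P` under a move of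
`z` differ by a single inner product. -/
lemma surrogate_shift {n d : ℕ} (f : RVec n → RVec d → ℝ) (rx ry : ℝ) (z w u : RVec n)
    (v : RVec d) : surrogate f rx ry (z + w) u v
      = surrogate f rx ry z u v + rx / 2 * (‖w‖ ^ 2 - 2 * inner ℝ w (u - z)) := by
  have : ‖u - (z + w)‖ ^ 2 = ‖u - z‖ ^ 2 - 2 * inner ℝ w (u - z) + ‖w‖ ^ 2 := by
    rw [← sub_sub, norm_sub_sq_real, real_inner_comm]
  simp only [surrogate, this]
  ring

/-- The scalar bookkeeping of the descent. Here `a`, `b` are the `x` and `y` steps, `ζ = ‖x⁺ - z‖`,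
`e` is the distance of `x⁺` from the exact minimizer, `g` the length of the dual step from that
minimizer, `h` its distance from the actual one, and `R` the distance from the saddle point to the
new minimizer. Each cross term is split by Young's inequality; 384 = 4 · 96 leaves the `ω` term only
`g²/(96 α)`. -/
lemma descent_arith {ℓ rx c α β ω a b e h g ζ R T : ℝ} (hℓ : 0 < ℓ) (hrx : 3 * ℓ < rx)
    (hc : 0 < c) (hc' : c * (rx + ℓ) < 1) (hα : 0 < α) (hα' : 11 * ℓ * α ≤ 1)
    (hβ : 0 < β) (hβ' : 36 * β ≤ 1) (hω' : 384 * rx * α * ω ^ 2 * β ≤ 1)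
    (hh : 0 ≤ h) (hg : 0 ≤ g) (hζ : 0 ≤ ζ)
    (hea : 4 * α * ℓ * e ^ 2 ≤ a ^ 2) (hhe : h ≤ α * ℓ * e) (hgb : g ≤ b + h)
    (hR : R ≤ ω * g + h / 2 + 3 / 2 * (β * ζ))
    (hT : 1 / (2 * c) * a ^ 2 + 1 / α * b ^ 2 - 2 * ℓ * e * b - 5 / 2 * ℓ * b ^ 2
      + rx / 2 * (2 * β - β ^ 2) * ζ ^ 2 - 2 * rx * (β * ζ) * R ≤ T) :
    ℓ * (a ^ 2 + b ^ 2 + β * ζ ^ 2) ≤ T := by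
  have hrx0 : 0 < rx := by linarith
  have e1 : 1 / (2 * c) = 1 / c / 2 := by field_simp
  rw [e1] at hT
  have hcA : rx + ℓ ≤ 1 / c := by rw [le_div_iff₀ hc]; linarith
  have hαA : 11 * ℓ ≤ 1 / α := by rw [le_div_iff₀ hα]; linarith
  have hαα : α * (1 / α) = 1 := by field_simp
  set C := 1 / c with hC
  set A := 1 / α with hA
  have hA0 : 0 < A := by positivity
  have k1 : 2 * ℓ * e * b ≤ A * b ^ 2 / 2 + ℓ * a ^ 2 / 2 := by
    have h1 : 0 ≤ A / 2 * (2 * α * ℓ * e - b) ^ 2 := by positivity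
    have h2 : A / 2 * (2 * α * ℓ * e - b) ^ 2
        = (α * A) * (2 * α * ℓ ^ 2 * e ^ 2) - (α * A) * (2 * ℓ * e * b) + A * b ^ 2 / 2 := by ring
    rw [h2, hαα] at h1
    have h3 := mul_le_mul_of_nonneg_left hea hℓ.le
    linarith
  have k2 : h ^ 2 ≤ α * ℓ * a ^ 2 / 4 := by
    have h1 := pow_le_pow_left₀ hh hhe 2
    have h2 := mul_le_mul_of_nonneg_left hea (by positivity : 0 ≤ α * ℓ)
    linarith
  have k2A : A * h ^ 2 ≤ ℓ * a ^ 2 / 4 := by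
    have h1 := mul_le_mul_of_nonneg_left k2 hA0.le
    have h2 : A * (α * ℓ * a ^ 2 / 4) = (α * A) * (ℓ * a ^ 2 / 4) := by ring
    rw [h2, hαα] at h1
    linarith
  have k3 : 2 * rx * (β * ζ) * (ω * g) ≤ rx * β * ζ ^ 2 / 4 + 4 * rx * β * ω ^ 2 * g ^ 2 := by
    have h1 : 0 ≤ rx * β * (ζ / 2 - 2 * ω * g) ^ 2 := by positivity
    linarith
  have k4 : 4 * rx * β * ω ^ 2 * g ^ 2 ≤ A * g ^ 2 / 96 := by
    have h1 := mul_le_mul_of_nonneg_left hω' (by positivity : 0 ≤ A * g ^ 2 / 96)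
    have h2 : A * g ^ 2 / 96 * (384 * rx * α * ω ^ 2 * β)
        = (α * A) * (4 * rx * β * ω ^ 2 * g ^ 2) := by ring
    rw [h2, hαα] at h1
    linarith
  have k5 : g ^ 2 ≤ 2 * b ^ 2 + 2 * h ^ 2 := by
    have h1 := pow_le_pow_left₀ hg hgb 2
    linarith [sq_nonneg (b - h)]
  have k5A := mul_le_mul_of_nonneg_left k5 hA0.le
  have k6 : rx * (β * ζ) * h ≤ rx * (β * ζ) ^ 2 + C * a ^ 2 / 176 := by
    have h1 : 0 ≤ rx * (β * ζ - h / 2) ^ 2 := by positivity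
    have h2 := mul_le_mul_of_nonneg_left k2 hrx0.le
    have h3 := mul_le_mul_of_nonneg_right hα' (by positivity : 0 ≤ rx * a ^ 2)
    have h4 := mul_le_mul_of_nonneg_right hcA (sq_nonneg a)
    have h5 : 0 ≤ ℓ * a ^ 2 := by positivity
    linarith
  have k7 : rx * (β * ζ) ^ 2 ≤ rx * β * ζ ^ 2 / 36 := by
    have := mul_le_mul_of_nonneg_right hβ' (by positivity : 0 ≤ rx * β * ζ ^ 2)
    linarith
  have k8 := mul_le_mul_of_nonneg_left hR (by positivity : 0 ≤ 2 * rx * (β * ζ))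
  have k9 := mul_le_mul_of_nonneg_right hcA (sq_nonneg a)
  have k10 := mul_le_mul_of_nonneg_right hαA (sq_nonneg b)
  have k11 := mul_le_mul_of_nonneg_right hrx.le (by positivity : 0 ≤ β * ζ ^ 2)
  have k12 := mul_le_mul_of_nonneg_right hrx.le (sq_nonneg a)
  have k13 : 0 ≤ ℓ * a ^ 2 := by positivity
  have k14 : 0 ≤ ℓ * b ^ 2 := by positivity
  have k15 : 0 ≤ ℓ * (β * ζ ^ 2) := by positivity
  linarith

variable {n d : ℕ} {X : Set (RVec n)} {Y : Set (RVec d)} {f : RVec n → RVec d → ℝ}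
  {ℓ rx ry c α β m M : ℝ} {z x : RVec n} {y : RVec d}

lemma potential_eq {p ps : RVec n} {ys : RVec d} (hP : IsNCCProblem X Y f ℓ) (hp : p ∈ X)
    (hmin : IsMinOn (fun u => surrogate f rx ry z u y) X p) (hps : ps ∈ X) (hys : ys ∈ Y)
    (hsmin : IsMinOn (fun u => surrogate f rx ry z u ys) X ps)
    (hsmax : IsMaxOn (fun v => surrogate f rx ry z ps v) Y ys) :
    potential X Y f rx ry x y z = surrogate f rx ry z x y - 2 * surrogate f rx ry z p y
      + 2 * surrogate f rx ry z ps ys := by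
  rw [potential, hmin.iInf_eq hp, iInf_iSup_surrogate_eq hP hps hys hsmin hsmax]

lemma potential_descent (hP : IsNCCProblem X Y f ℓ) (hS : StepSizeCondition m M ℓ rx ry c α β)
    (hry : ry ≤ ℓ) (hx : x ∈ X) (hy : y ∈ Y) {xn : RVec n} {yn : RVec d}
    (hxn : IsProjOnto X (x - c • surrogateGradX f rx z x y) xn)
    (hyn : IsProjOnto Y (y + α • surrogateGradY f ry xn y) yn) :
    ℓ * (‖xn - x‖ ^ 2 + ‖yn - y‖ ^ 2 + β * ‖xn - z‖ ^ 2)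
      ≤ potential X Y f rx ry x y z - potential X Y f rx ry xn yn (z + β • (xn - z)) := by
  have hℓ := hP.smooth.pos
  have hrx := hS.rx_gt
  have hrx0 : 0 < rx := by linarith
  have hμ : 0 < rx - ℓ := by linarith
  have hα := hS.α_pos
  have hc := hS.c_pos
  have hβ := hS.β_pos
  have hry0 := hS.ry_pos
  have hc' : c * (rx + ℓ) < 1 := by
    have := hS.c_lt
    rwa [lt_div_iff₀ (by linarith)] at this
  set w := β • (xn - z) with hw
  have hwn : ‖w‖ = β * ‖xn - z‖ := by rw [hw, norm_smul, Real.norm_of_nonneg hβ.le]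
  obtain ⟨p, hp, hpm⟩ := exists_isMinOn_surrogate hP (ry := ry) (by linarith : ℓ < rx) hx hy z
  obtain ⟨p2, hp2, hp2m⟩ :=
    exists_isMinOn_surrogate hP (ry := ry) (by linarith : ℓ < rx) hx hyn.1 (z + w)
  obtain ⟨ps, hps, ys, hys, hsm, hsM⟩ := exists_saddle hP hrx hry0.le hry hx z
  obtain ⟨ps', hps', ys', hys', hsm', hsM'⟩ := exists_saddle hP hrx hry0.le hry hx (z + w)
  -- The idealized dual step, with the gradient at the exact minimizer `p`; the dual error bound
  -- applies to it rather than to `yn`.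
  obtain ⟨yp, hyp⟩ := exists_isProjOnto hP.compact_Y ⟨0, hP.zero_mem_Y⟩
    (y + α • surrogateGradY f ry p y)
  obtain ⟨q, hq, hqm⟩ := exists_isMinOn_surrogate hP (ry := ry) (by linarith : ℓ < rx) hx hyp.1 z
  rw [potential_eq hP hp hpm hps hys hsm hsM, potential_eq hP hp2 hp2m hps' hys' hsm' hsM']
  have e1 := surrogate_shift f rx ry z w p2 yn
  have e2 := surrogate_shift f rx ry z w xn yn
  have e3 := surrogate_shift f rx ry z w ps ys'
  -- `p2` minimizes for the shifted centre, not for `z`; this is admissible because the model holds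
  -- at every point of `X`.
  have h1 := dual_ascent hP hrx hry hy hyn.1 hp hp2 hpm
  have h2 : surrogate f rx ry (z + w) ps' ys' ≤ surrogate f rx ry (z + w) ps ys' := hsm' hps
  have h3 : surrogate f rx ry z ps ys' ≤ surrogate f rx ry z ps ys := hsM hys'
  have h4 := surrogate_projGrad_le hP hc hc' hx hy hxn (ry := ry)
  have h5 := surrogate_right_le hP (rx := rx) (ry := ry) (z := z) hxn.1 hy hyn.1
  have h6 : 1 / α * ‖yn - y‖ ^ 2 ≤ inner ℝ (surrogateGradY f ry xn y) (yn - y) := by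
    have h7 := hyn.inner_le_zero hP.convex_Y hy
    have e : inner ℝ (y + α • surrogateGradY f ry xn y - yn) (y - yn)
        = ‖yn - y‖ ^ 2 - α * inner ℝ (surrogateGradY f ry xn y) (yn - y) := by
      rw [norm_sub_rev, ← real_inner_self_eq_norm_sq, ← real_inner_smul_left, ← neg_sub y yn,
        inner_neg_right, sub_neg_eq_add, ← inner_add_left]
      congr 1; abel
    rw [div_mul_eq_mul_div, one_mul, div_le_iff₀ hα]
    linarith
  have h7 : inner ℝ (surrogateGradY f ry xn y) (yn - y) - ℓ * ‖xn - p‖ * ‖yn - y‖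
      ≤ inner ℝ (surrogateGradY f ry p y) (yn - y) := by
    have e : inner ℝ (surrogateGradY f ry xn y) (yn - y)
        = inner ℝ (surrogateGradY f ry p y) (yn - y)
          + inner ℝ (gradY f xn y - gradY f p y) (yn - y) := by
      rw [← inner_add_left]; congr 1; simp only [surrogateGradY]; abel
    have h8 := real_inner_le_norm (gradY f xn y - gradY f p y) (yn - y)
    have h9 := hP.smooth.lipY xn hxn.1 p hp y hy y hy
    rw [sub_self, norm_zero, add_zero] at h9
    have := mul_le_mul_of_nonneg_right h9 (norm_nonneg (yn - y))
    linarith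
  have e4 : inner ℝ w (xn - z) = β * ‖xn - z‖ ^ 2 := by
    rw [hw, real_inner_smul_left, real_inner_self_eq_norm_sq]
  have e5 : inner ℝ w (ps - z) - inner ℝ w (p2 - z) = inner ℝ w (ps - p2) := by
    rw [← inner_sub_right]; congr 1; abel
  have h8 := neg_le_of_abs_le (abs_real_inner_le_norm w (ps - p2))
  rw [hwn] at h8 e1 e2 e3
  rw [e4] at e2
  have h9 : ‖yn - yp‖ ≤ α * ℓ * ‖xn - p‖ := by
    have h10 := hyn.norm_sub_le hP.convex_Y hyp
    have e : y + α • surrogateGradY f ry xn y - (y + α • surrogateGradY f ry p y)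
        = α • (gradY f xn y - gradY f p y) := by simp only [surrogateGradY]; module
    rw [e, norm_smul, Real.norm_of_nonneg hα.le] at h10
    have h11 := hP.smooth.lipY xn hxn.1 p hp y hy y hy
    rw [sub_self, norm_zero, add_zero] at h11
    have := mul_le_mul_of_nonneg_left h11 hα.le
    linarith
  have h10 : ‖y - yp‖ ≤ ‖yn - y‖ + ‖yn - yp‖ := by
    rw [norm_sub_rev yn y]; exact norm_sub_le_norm_sub_add_norm_sub y yn yp
  have h11 := dual_error_bound hP hα hrx hry0 hry hps hys hsm hsM hy hp hpm hyp hq hqm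
  -- From `rx > 3ℓ`: `ℓ/(rx - ℓ) ≤ 1/2` and `rx/(rx - ℓ) ≤ 3/2`.
  have h12 : ‖q - p2‖ ≤ ‖yn - yp‖ / 2 + 3 / 2 * (β * ‖xn - z‖) := by
    have h13 := minimizer_lipschitz hP (by linarith : ℓ < rx) hyp.1 hyn.1 hq hp2 hqm hp2m
    rw [sub_add_cancel_left, norm_neg, hwn, norm_sub_rev yp] at h13
    refine le_of_mul_le_mul_left (h13.trans ?_) hμ
    have h14 : 0 ≤ (rx - 3 * ℓ) * ‖yn - yp‖ := mul_nonneg (by linarith) (norm_nonneg _)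
    have h15 : 0 ≤ (rx - 3 * ℓ) * (β * ‖xn - z‖) := mul_nonneg (by linarith) (by positivity)
    linarith
  have h13 : ‖ps - p2‖ ≤ omegaConst ℓ rx ry α * ‖y - yp‖ + ‖yn - yp‖ / 2
      + 3 / 2 * (β * ‖xn - z‖) := by
    have := norm_sub_le_norm_sub_add_norm_sub ps q p2
    linarith
  have hα' := (le_min_iff.1 hS.α_le)
  have h14 : 4 * α * ℓ * ‖xn - p‖ ^ 2 ≤ ‖xn - x‖ ^ 2 := by
    have h15 := projGrad_error_bound hP hc (by linarith) hc' hx hy hp hpm hxn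
    have h16 := hα'.2
    have hk : 0 < c * (rx - ℓ) := by positivity
    rw [le_div_iff₀ (by positivity), ← mul_pow] at h16
    set k := c * (rx - ℓ) with hkdef
    -- Weaker than the step-size condition, whose extra factor `(1 + k)²` is discarded.
    have h17 : 4 * α * ℓ ≤ k ^ 2 := by
      have : 0 ≤ 4 * α * ℓ * (2 * k + k ^ 2) := by positivity
      linarith
    have h18 := mul_le_mul_of_nonneg_right h17 (sq_nonneg ‖xn - p‖)
    have h19 := pow_le_pow_left₀ (by positivity) h15 2
    rw [mul_pow] at h19
    linarith
  have hω' : 384 * rx * α * omegaConst ℓ rx ry α ^ 2 * β ≤ 1 := by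
    have h15 := hS.β_le_omega
    rcases (by positivity : 0 ≤ 384 * rx * α * omegaConst ℓ rx ry α ^ 2).eq_or_lt with h0 | h0
    · rw [← h0]; norm_num
    · rw [le_div_iff₀ h0] at h15
      linarith
  refine descent_arith (R := ‖ps - p2‖) (e := ‖xn - p‖) (h := ‖yn - yp‖) (g := ‖y - yp‖)
    hℓ hrx hc hc' hα ?_ hβ ?_ hω' (norm_nonneg _) (norm_nonneg _)
    (norm_nonneg _) h14 h9 h10 h13 ?_
  · have := hα'.1
    rw [le_div_iff₀ (by positivity)] at this
    linarith
  · have := (le_min_iff.1 hS.β_le).1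
    linarith
  · have h15 := mul_le_mul_of_nonneg_left h8 hrx0.le
    rw [← e5] at h15
    have h16 : 0 ≤ ry / 2 * ‖yn - y‖ ^ 2 := by positivity
    linarith

lemma iInf_iSup_pertObj_le_potential (hP : IsNCCProblem X Y f ℓ) (hrx : 3 * ℓ < rx)
    (hry0 : 0 ≤ ry) (hry : ry ≤ ℓ) (hx : x ∈ X) (hy : y ∈ Y) :
    (⨅ u : X, ⨆ v : Y, pertObj f ry u v) ≤ potential X Y f rx ry x y z := by
  have hℓ := hP.smooth.pos
  have hrx0 : 0 < rx := by linarith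
  have hne : Nonempty Y := ⟨⟨0, hP.zero_mem_Y⟩⟩
  have hs0 : ∀ u v, surrogate f 0 ry z u v = pertObj f ry u v := by
    intro u v; simp [surrogate, pertObj]
  have hbdd : ∀ u, BddAbove (range fun v : Y => pertObj f ry u v) := by
    intro u
    simpa only [hs0] using bddAbove_surrogate_right hP 0 ry z u
  obtain ⟨p, hp, hpm⟩ := exists_isMinOn_surrogate hP (ry := ry) (by linarith : ℓ < rx) hx hy z
  obtain ⟨ps, hps, ys, hys, hsm, hsM⟩ := exists_saddle hP hrx hry0 hry hx z
  rw [potential_eq hP hp hpm hps hys hsm hsM]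
  have h1 : surrogate f rx ry z p y ≤ surrogate f rx ry z x y := hpm hx
  have h2 : surrogate f rx ry z p y ≤ surrogate f rx ry z ps y := hpm hps
  have h3 : surrogate f rx ry z ps y ≤ surrogate f rx ry z ps ys := hsM hy
  have h4 : (⨆ v : Y, pertObj f ry ps v) ≤ surrogate f rx ry z ps ys := by
    refine ciSup_le fun v => ?_
    refine le_trans ?_ (hsM v.2 : surrogate f rx ry z ps v ≤ _)
    have : 0 ≤ rx / 2 * ‖ps - z‖ ^ 2 := by positivity
    simp only [pertObj, surrogate]
    linarith
  -- The perturbation lowers the primal value by at most `ry/2 · D²`, since `0 ∈ Y` gives `‖v‖ ≤ D`.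
  have h5 : BddBelow (range fun u : X => ⨆ v : Y, pertObj f ry u v) := by
    obtain ⟨B, hB⟩ := hP.bddBelow
    refine ⟨B - ry / 2 * Metric.diam Y ^ 2, ?_⟩
    rintro _ ⟨u, rfl⟩
    have h6 : B ≤ primalValue Y f u := hB ⟨u, u.2, rfl⟩
    have h7 : primalValue Y f u ≤ (⨆ v : Y, pertObj f ry u v) + ry / 2 * Metric.diam Y ^ 2 := by
      refine ciSup_le fun v => ?_
      have h8 := le_ciSup (hbdd u) v
      have h9 : ‖(v : RVec d)‖ ≤ Metric.diam Y := by
        simpa using Metric.dist_le_diam_of_mem hP.compact_Y.isBounded v.2 hP.zero_mem_Y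
      have h10 := mul_le_mul_of_nonneg_left (pow_le_pow_left₀ (norm_nonneg _) h9 2)
        (by positivity : 0 ≤ ry / 2)
      simp only [pertObj] at h8 ⊢
      linarith
    show _ ≤ (⨆ v : Y, pertObj f ry u v)
    linarith
  have h6 := ciInf_le h5 ⟨ps, hps⟩
  simp only at h6
  linarith

/-- Some early iterate of Perturbed Smoothed GDA moves by little. -/
lemma exists_small_step {x : ℕ → RVec n} {y : ℕ → RVec d} {z : ℕ → RVec n} {δ : ℝ}
    (hP : IsNCCProblem X Y f ℓ) (hS : StepSizeCondition m M ℓ rx ry c α β) (hry : ry ≤ ℓ)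
    (hG : IsPerturbedSmoothedGDA X Y f rx ry c α β x y z) (hδ : 0 < δ) :
    ∃ t : ℕ, (t : ℝ) ≤ initialGap X Y f rx ry (x 0) (y 0) (z 0) / δ ∧
      ℓ * (‖x (t + 1) - x t‖ ^ 2 + ‖y (t + 1) - y t‖ ^ 2 + β * ‖x (t + 1) - z t‖ ^ 2) ≤ δ := by
  have hx : ∀ t, x t ∈ X := fun t => by
    cases t with
    | zero => exact hG.init_x
    | succ t => exact (hG.step_x t).1
  have hy : ∀ t, y t ∈ Y := fun t => by
    cases t with
    | zero => exact hG.init_y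
    | succ t => exact (hG.step_y t).1
  refine exists_le_of_descent (Ψ := fun t => potential X Y f rx ry (x t) (y t) (z t)) hδ
    (fun t => iInf_iSup_pertObj_le_potential hP hS.rx_gt hS.ry_pos.le hry (hx t) (hy t)) ?_
  intro t
  have h1 := hG.step_x t
  have h2 := hG.step_y t
  rw [gradX_surrogate hP.smooth] at h1
  rw [gradY_surrogate hP.smooth] at h2
  have := potential_descent hP hS hry (hx t) (hy t) h1 h2
  rwa [← hG.step_z t] at this

end Descent

/-! ### From small movement to stationarity -/

section Stationarity

variable {n d : ℕ} {X : Set (RVec n)} {Y : Set (RVec d)} {f : RVec n → RVec d → ℝ}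
  {ℓ rx ry c α β m M : ℝ} {z x xn : RVec n} {y yn : RVec d}

lemma norm_le_diam_of_mem (hP : IsNCCProblem X Y f ℓ) (hy : y ∈ Y) : ‖y‖ ≤ Metric.diam Y := by
  simpa using Metric.dist_le_diam_of_mem hP.compact_Y.isBounded hy hP.zero_mem_Y

/-- The scaled projection defect is a normal vector at `xn`. It contains minus the old gradient, so
only a gradient difference, the step and the proximal pull towards `z` survive. -/
lemma exists_primal_residual (hP : IsNCCProblem X Y f ℓ) (hc : 0 < c) (hrx : 0 ≤ rx) (hx : x ∈ X)
    (hy : y ∈ Y) (hyn : yn ∈ Y) (hxn : IsProjOnto X (x - c • surrogateGradX f rx z x y) xn) :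
    ∃ v ∈ indicatorSubdiff X xn, ‖gradX f xn yn + v‖
      ≤ (1 / c + ℓ + rx) * ‖xn - x‖ + ℓ * ‖yn - y‖ + rx * ‖xn - z‖ := by
  refine ⟨(1 / c) • (x - c • surrogateGradX f rx z x y - xn), ⟨hxn.1, fun w hw => ?_⟩, ?_⟩
  · rw [real_inner_smul_left]
    exact mul_nonpos_of_nonneg_of_nonpos (by positivity) (hxn.inner_le_zero hP.convex_X hw)
  · have e : gradX f xn yn + (1 / c) • (x - c • surrogateGradX f rx z x y - xn)
        = (1 / c) • (x - xn) + (gradX f xn yn - gradX f x y) + rx • (xn - x) - rx • (xn - z) := by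
      have : (1 / c) • c • surrogateGradX f rx z x y = surrogateGradX f rx z x y := by
        rw [smul_smul, one_div_mul_cancel hc.ne', one_smul]
      rw [smul_sub, smul_sub, this, surrogateGradX]
      module
    rw [e]
    have h1 := hP.smooth.lipX xn hxn.1 x hx yn hyn y hy
    have h2 := norm_sub_le ((1 / c) • (x - xn) + (gradX f xn yn - gradX f x y) + rx • (xn - x))
      (rx • (xn - z))
    have h3 := norm_add₃_le (a := (1 / c) • (x - xn)) (b := gradX f xn yn - gradX f x y)
      (c := rx • (xn - x))
    rw [norm_smul, norm_smul, Real.norm_of_nonneg (by positivity), Real.norm_of_nonneg hrx,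
      norm_sub_rev x xn] at h3
    rw [norm_smul rx (xn - z), Real.norm_of_nonneg hrx] at h2
    linarith

/-- The dual analogue; the perturbation leaves the bias `ry • y`, which does not vanish with the
step. -/
lemma exists_dual_residual (hP : IsNCCProblem X Y f ℓ) (hα : 0 < α) (hry : 0 ≤ ry) (hxn : xn ∈ X)
    (hy : y ∈ Y) (hyn : IsProjOnto Y (y + α • surrogateGradY f ry xn y) yn) :
    ∃ v ∈ indicatorSubdiff Y yn, ‖-gradY f xn yn + v‖
      ≤ (1 / α + ℓ) * ‖yn - y‖ + ry * Metric.diam Y := by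
  refine ⟨(1 / α) • (y + α • surrogateGradY f ry xn y - yn), ⟨hyn.1, fun w hw => ?_⟩, ?_⟩
  · rw [real_inner_smul_left]
    exact mul_nonpos_of_nonneg_of_nonpos (by positivity) (hyn.inner_le_zero hP.convex_Y hw)
  · have e : -gradY f xn yn + (1 / α) • (y + α • surrogateGradY f ry xn y - yn)
        = (1 / α) • (y - yn) + (gradY f xn y - gradY f xn yn) - ry • y := by
      have : (1 / α) • α • surrogateGradY f ry xn y = surrogateGradY f ry xn y := by
        rw [smul_smul, one_div_mul_cancel hα.ne', one_smul]
      rw [smul_sub, smul_add, this, surrogateGradY]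
      module
    rw [e]
    have h1 := hP.smooth.lipY_right hxn y hy yn hyn.1
    have h2 := norm_sub_le ((1 / α) • (y - yn) + (gradY f xn y - gradY f xn yn)) (ry • y)
    have h3 := norm_add_le ((1 / α) • (y - yn)) (gradY f xn y - gradY f xn yn)
    rw [norm_smul, Real.norm_of_nonneg (by positivity)] at h3
    rw [norm_smul ry y, Real.norm_of_nonneg hry] at h2
    rw [norm_sub_rev y yn] at h1 h3
    have h4 := mul_le_mul_of_nonneg_left (norm_le_diam_of_mem hP hy) hry
    linarith

lemma IsNCCProblem.continuous_primalValue (hP : IsNCCProblem X Y f ℓ) :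
    Continuous (primalValue Y f) := by
  have h : primalValue Y f = fun x => sSup (f x '' Y) := by
    funext x; rw [primalValue, sSup_image']
  rw [h]
  exact hP.compact_Y.continuous_sSup hP.smooth.continuous

lemma IsNCCProblem.le_primalValue (hP : IsNCCProblem X Y f ℓ) (x : RVec n) (hy : y ∈ Y) :
    f x y ≤ primalValue Y f x := by
  have h1 : Continuous (f x) :=
    hP.smooth.continuous.comp (by fun_prop : Continuous fun v : RVec d => (x, v))
  have h2 := (hP.compact_Y.image h1).bddAbove
  rw [image_eq_range] at h2
  exact le_ciSup h2 ⟨y, hy⟩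

lemma IsNCCProblem.exists_eq_primalValue (hP : IsNCCProblem X Y f ℓ) (x : RVec n) :
    ∃ y ∈ Y, primalValue Y f x = f x y := by
  have h1 : Continuous (f x) :=
    hP.smooth.continuous.comp (by fun_prop : Continuous fun v : RVec d => (x, v))
  obtain ⟨y, hy, hm⟩ := hP.compact_Y.exists_isMaxOn ⟨0, hP.zero_mem_Y⟩ h1.continuousOn
  exact ⟨y, hy, hm.iSup_eq hy⟩

/-- The primal value function is `ℓ`-weakly convex on `X`. -/
lemma primalValue_weakly_convex (hP : IsNCCProblem X Y f ℓ) {p : RVec n} (hp : p ∈ X) (hx : x ∈ X)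
    {s : ℝ} (h0 : 0 ≤ s) (h1 : s ≤ 1) :
    primalValue Y f (p + s • (x - p)) ≤ (1 - s) * primalValue Y f p + s * primalValue Y f x
      + ℓ / 2 * (s * (1 - s)) * ‖x - p‖ ^ 2 := by
  set u := p + s • (x - p) with hu
  have huX : u ∈ X := convex_segment_mem hP.convex_X hp hx h0 h1
  -- Fixing the maximizer at the intermediate point reduces both endpoint comparisons to one smooth
  -- function `f(·, v)`.
  obtain ⟨v, hv, hve⟩ := hP.exists_eq_primalValue u
  have h2 := add_inner_sub_sq_le_of_lipschitz_gradient
    (fun w => hP.smooth.hasGradientAt_left w v) hP.convex_X (hP.smooth.lipX_left hv) huX hp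
  have h3 := add_inner_sub_sq_le_of_lipschitz_gradient
    (fun w => hP.smooth.hasGradientAt_left w v) hP.convex_X (hP.smooth.lipX_left hv) huX hx
  have e1 : p - u = (-s) • (x - p) := by rw [hu]; module
  have e2 : x - u = (1 - s) • (x - p) := by rw [hu]; module
  rw [e1, inner_smul_right, norm_smul, mul_pow, Real.norm_eq_abs, sq_abs] at h2
  rw [e2, inner_smul_right, norm_smul, mul_pow, Real.norm_eq_abs, sq_abs] at h3
  have h4 := mul_le_mul_of_nonneg_left (h2.trans (hP.le_primalValue p hv)) (sub_nonneg.2 h1)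
  have h5 := mul_le_mul_of_nonneg_left (h3.trans (hP.le_primalValue x hv)) h0
  rw [hve]
  linarith

lemma exists_isProx (hP : IsNCCProblem X Y f ℓ) (hx : x ∈ X) :
    ∃ p, IsProx X Y f (1 / (2 * ℓ)) x p := by
  have hℓ := hP.smooth.pos
  obtain ⟨B, hB⟩ := hP.bddBelow
  have hc := hP.continuous_primalValue
  have e : 1 / (2 * (1 / (2 * ℓ))) = ℓ := by field_simp
  have hB' : ∀ w ∈ X, B ≤ primalValue Y f w := fun w hw => hB ⟨w, hw, rfl⟩
  -- The summand 1 ensures `‖w - x‖² ≥ ‖w - x‖` outside the ball.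
  refine exists_isMinOn_of_le_of_lt_norm (R := 1 + (primalValue Y f x - B) / ℓ) hP.closed_X hx
    (by fun_prop) fun w hw hR => ?_
  have h1 : 0 ≤ (primalValue Y f x - B) / ℓ := div_nonneg (by linarith [hB' x hx]) hℓ.le
  have h2 : (primalValue Y f x - B) / ℓ ≤ ‖w - x‖ ^ 2 := by nlinarith
  rw [div_le_iff₀ hℓ] at h2
  simp only [e, sub_self, norm_zero]
  linarith [hB' w hw]

/-- Adding `ℓ ‖· - x‖²` to an `ℓ`-weakly convex function makes it `ℓ`-strongly convex; its growth
`ℓ/2` at the minimizer `p` joins the proximal cost `ℓ`. -/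
lemma primalValue_prox_add_le (hP : IsNCCProblem X Y f ℓ) (hx : x ∈ X) {p : RVec n}
    (hp : IsProx X Y f (1 / (2 * ℓ)) x p) :
    primalValue Y f p + 3 / 2 * ℓ * ‖p - x‖ ^ 2 ≤ primalValue Y f x := by
  have hℓ := hP.smooth.pos
  have e : 1 / (2 * (1 / (2 * ℓ))) = ℓ := by field_simp
  have key := nonpos_of_forall_mul_le
    (a := primalValue Y f p + 3 / 2 * ℓ * ‖p - x‖ ^ 2 - primalValue Y f x)
    (b := 1 / 2 * ℓ * ‖p - x‖ ^ 2) (by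
    intro s h0 h1
    have h2 := primalValue_weakly_convex hP hp.1 hx h0.le h1
    have h3 := hp.2 (convex_segment_mem hP.convex_X hp.1 hx h0.le h1)
    have e2 : p + s • (x - p) - x = (1 - s) • (p - x) := by module
    simp only [mem_ofPred_eq, e, e2, norm_smul, mul_pow, Real.norm_eq_abs, sq_abs] at h3
    rw [norm_sub_rev x p] at h2
    linarith)
  linarith

/-- The distance to the proximal point in terms of the residuals of an approximate game
stationary point. -/
lemma prox_sq_le (hP : IsNCCProblem X Y f ℓ) {p v : RVec n} {w : RVec d}
    (hp : IsProx X Y f (1 / (2 * ℓ)) x p) (hv : v ∈ indicatorSubdiff X x)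
    (hw : w ∈ indicatorSubdiff Y y) :
    ℓ * ‖p - x‖ ^ 2 ≤ ‖-gradY f x y + w‖ * Metric.diam Y + ‖gradX f x y + v‖ * ‖p - x‖ := by
  have hx := hv.1
  have hy := hw.1
  have h1 := primalValue_prox_add_le hP hx hp
  obtain ⟨u, hu, hue⟩ := hP.exists_eq_primalValue x
  have h2 := (hP.concave x hx).le_add_inner_gradient
    (fun w => hP.smooth.hasGradientAt_right x w) hy hu
  have h3 := add_inner_sub_sq_le_of_lipschitz_gradient
    (fun w => hP.smooth.hasGradientAt_left w y) hP.convex_X (hP.smooth.lipX_left hy) hx hp.1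
  have h4 := hP.le_primalValue p hy
  have h5 := hv.2 p hp.1
  have h6 := hw.2 u hu
  have h7 := neg_le_of_abs_le (abs_real_inner_le_norm (gradX f x y + v) (p - x))
  have h8 := neg_le_of_abs_le (abs_real_inner_le_norm (-gradY f x y + w) (u - y))
  rw [inner_add_left] at h7 h8
  rw [inner_neg_left] at h8
  have h9 : ‖u - y‖ ≤ Metric.diam Y := by
    rw [← dist_eq_norm]; exact Metric.dist_le_diam_of_mem hP.compact_Y.isBounded hu hy
  have h10 := mul_le_mul_of_nonneg_left h9 (norm_nonneg (-gradY f x y + w))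
  linarith

/-- The smallest weight is `β`, so a budget calibrated to it controls all three movements. -/
lemma le_of_weighted_sq_le {ℓ β a b ζ δ s : ℝ} (hℓ : 0 < ℓ) (hβ : 0 < β) (hβ1 : β ≤ 1)
    (hs : 0 ≤ s) (ha : 0 ≤ a) (hb : 0 ≤ b) (hζ : 0 ≤ ζ)
    (h : ℓ * (a ^ 2 + b ^ 2 + β * ζ ^ 2) ≤ δ) (hδ : δ ≤ ℓ * (β * s ^ 2)) :
    a ≤ s ∧ b ≤ s ∧ ζ ≤ s := by
  have h1 := le_of_mul_le_mul_left (h.trans hδ) hℓ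
  have h2 : β * s ^ 2 ≤ s ^ 2 := mul_le_of_le_one_left (sq_nonneg s) hβ1
  have h3 : 0 ≤ β * ζ ^ 2 := by positivity
  refine ⟨(sq_le_sq₀ ha hs).1 ?_, (sq_le_sq₀ hb hs).1 ?_,
    (sq_le_sq₀ hζ hs).1 (le_of_mul_le_mul_left ?_ hβ)⟩
  · nlinarith
  · nlinarith
  · nlinarith

/-- Along the run, some early iterate has residuals bounded by its (small) last step. -/
lemma exists_residuals_le {x : ℕ → RVec n} {y : ℕ → RVec d} {z : ℕ → RVec n} {δ s : ℝ}
    (hm : 0 < m) (hP : IsNCCProblem X Y f ℓ) (hS : StepSizeCondition m M ℓ rx ry c α β)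
    (hry : ry ≤ ℓ) (hG : IsPerturbedSmoothedGDA X Y f rx ry c α β x y z) (hδ : 0 < δ)
    (hs : 0 ≤ s) (hδs : δ ≤ ℓ * (β * s ^ 2)) :
    ∃ t : ℕ, (t : ℝ) ≤ initialGap X Y f rx ry (x 0) (y 0) (z 0) / δ ∧
      ∃ v ∈ indicatorSubdiff X (x (t + 1)), ∃ w ∈ indicatorSubdiff Y (y (t + 1)), ∃ b : ℝ,
        0 ≤ b ∧ b ≤ s ∧ ℓ * b ^ 2 ≤ δ ∧
        ‖gradX f (x (t + 1)) (y (t + 1)) + v‖ ≤ 3 * (1 / m + 1 + |M|) * ℓ * s ∧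
        ‖-gradY f (x (t + 1)) (y (t + 1)) + w‖
          ≤ (1 / m + 1 + |M|) * ℓ * b + ry * Metric.diam Y := by
  have hℓ := hP.smooth.pos
  have hrx0 : 0 < rx := by linarith [hS.rx_gt]
  obtain ⟨t, ht, hst⟩ := exists_small_step hP hS hry hG hδ
  have hx : x t ∈ X := by
    cases t with
    | zero => exact hG.init_x
    | succ t => exact (hG.step_x t).1
  have hy : y t ∈ Y := by
    cases t with
    | zero => exact hG.init_y
    | succ t => exact (hG.step_y t).1
  have h1 := hG.step_x t
  have h2 := hG.step_y t
  rw [gradX_surrogate hP.smooth] at h1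
  rw [gradY_surrogate hP.smooth] at h2
  obtain ⟨v, hv, hvn⟩ := exists_primal_residual hP hS.c_pos hrx0.le hx hy h2.1 h1
  obtain ⟨w, hw, hwn⟩ := exists_dual_residual hP hS.α_pos hS.ry_pos.le h1.1 hy h2
  have hβ1 : β ≤ 1 := ((le_min_iff.1 hS.β_le).1).trans (by norm_num)
  obtain ⟨ha, hb, hζ⟩ := le_of_weighted_sq_le hℓ hS.β_pos hβ1 hs (norm_nonneg _) (norm_nonneg _)
    (norm_nonneg _) hst hδs
  have inv_le : ∀ r : ℝ, 0 < r → m * (1 / ℓ) ≤ r → 1 / r ≤ 1 / m * ℓ := by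
    intro r hr h
    rw [div_le_iff₀ hr]
    have := mul_le_mul_of_nonneg_left h (by positivity : 0 ≤ 1 / m * ℓ)
    have e : 1 / m * ℓ * (m * (1 / ℓ)) = 1 := by field_simp
    linarith
  have hc := inv_le c hS.c_pos hS.c_theta.1
  have hα := inv_le α hS.α_pos hS.α_theta.1
  have hrxM : rx ≤ |M| * ℓ :=
    hS.rx_theta.2.trans (mul_le_mul_of_nonneg_right (le_abs_self M) hℓ.le)
  have hM : 0 ≤ |M| * ℓ := by positivity
  have hm' : 0 ≤ 1 / m * ℓ := by positivity
  -- The dual step is reported separately because `ℓ b² ≤ δ` carries no factor `β`; optimization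
  -- stationarity needs this sharper bound.
  refine ⟨t, ht, v, hv, w, hw, ‖y (t + 1) - y t‖, norm_nonneg _, hb, ?_, hvn.trans ?_,
    hwn.trans ?_⟩
  · refine le_trans (mul_le_mul_of_nonneg_left ?_ hℓ.le) hst
    have : 0 ≤ β * ‖x (t + 1) - z t‖ ^ 2 := mul_nonneg hS.β_pos.le (sq_nonneg _)
    linarith [sq_nonneg ‖x (t + 1) - x t‖]
  · have k1 : (1 / c + ℓ + rx) * ‖x (t + 1) - x t‖ ≤ (1 / m + 1 + |M|) * ℓ * s :=
      mul_le_mul (by linarith) ha (norm_nonneg _) (by linarith)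
    have k2 : ℓ * ‖y (t + 1) - y t‖ ≤ (1 / m + 1 + |M|) * ℓ * s :=
      mul_le_mul (by linarith) hb (norm_nonneg _) (by linarith)
    have k3 : rx * ‖x (t + 1) - z t‖ ≤ (1 / m + 1 + |M|) * ℓ * s :=
      mul_le_mul (by linarith) hζ (norm_nonneg _) (by linarith)
    linarith
  · have := mul_le_mul_of_nonneg_right (by linarith : 1 / α + ℓ ≤ (1 / m + 1 + |M|) * ℓ)
      (norm_nonneg (y (t + 1) - y t))
    linarith

end Stationarity

/-! ### Calibration of the constants -/

theorem mainTheorem1 (m M : ℝ) (hm : 0 < m) :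
    -- game stationarity
    (∀ κ : ℝ, κ < 1 → ∃ C : ℝ, 0 < C ∧
      ∀ (n d : ℕ) (X : Set (RVec n)) (Y : Set (RVec d)) (f : RVec n → RVec d → ℝ)
        (ℓ ε rx ry c α β : ℝ) (x : ℕ → RVec n) (y : ℕ → RVec d) (z : ℕ → RVec n),
        IsNCCProblem X Y f ℓ →
        0 < ε →
        StepSizeCondition m M ℓ rx ry c α β →
        ry ≤ ℓ →
        IsThetaWith m κ ry (ε / Metric.diam Y) →
        IsPerturbedSmoothedGDA X Y f rx ry c α β x y z →
        ∃ t : ℕ,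
          (t : ℝ) ≤ C * (ℓ ^ 2 * Metric.diam Y * initialGap X Y f rx ry (x 0) (y 0) (z 0)
            / ε ^ 3) ∧
          IsGameStationary X Y f ε (x (t + 1)) (y (t + 1))) ∧
    -- optimization stationarity
    (∀ κ : ℝ, κ < 1 / 4 → ∃ C : ℝ, 0 < C ∧
      ∀ (n d : ℕ) (X : Set (RVec n)) (Y : Set (RVec d)) (f : RVec n → RVec d → ℝ)
        (ℓ ε rx ry c α β : ℝ) (x : ℕ → RVec n) (y : ℕ → RVec d) (z : ℕ → RVec n),
        IsNCCProblem X Y f ℓ →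
        0 < ε →
        StepSizeCondition m M ℓ rx ry c α β →
        ry ≤ ℓ →
        IsThetaWith m κ ry (ε ^ 2 / (ℓ * Metric.diam Y ^ 2)) →
        IsPerturbedSmoothedGDA X Y f rx ry c α β x y z →
        ∃ t : ℕ,
          (t : ℝ) ≤ C * (ℓ ^ 3 * Metric.diam Y ^ 2
            * initialGap X Y f rx ry (x 0) (y 0) (z 0) / ε ^ 4) ∧
          IsOptStationary X Y f ℓ ε (x (t + 1))) := by
  have hA : 0 < 1 / m + 1 + |M| := by positivity
  set A := 1 / m + 1 + |M| with hAdef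
  have κ_pos : ∀ κ r v : ℝ, 0 < r → 0 < v → r ≤ κ * v → 0 < κ := fun κ r v hr hv h =>
    pos_of_mul_pos_left (hr.trans_le h) hv.le
  constructor
  · intro κ hκ
    -- With `s = τ ε/ℓ` the primal residual is at most `(1 - κ) ε`; the dual one is at most `(1 - κ)
    -- ε/3` plus the bias `κ ε`.
    set τ := (1 - κ) / (3 * A) with hτ
    have hτ0 : 0 < τ := div_pos (by linarith) (by positivity)
    have hAτ : 3 * A * τ = 1 - κ := by rw [hτ]; field_simp
    refine ⟨1 / (τ ^ 2 * m ^ 2), by positivity, ?_⟩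
    intro n d X Y f ℓ ε rx ry c α β x y z hP hε hS hry hθ hG
    have hℓ := hP.smooth.pos
    have hD := hP.diam_pos
    set D := Metric.diam Y with hDdef
    have hκ0 := κ_pos κ ry _ hS.ry_pos (by positivity) hθ.2
    have hβ : m * (m * (ε / D) / ℓ) ≤ β :=
      le_trans (by gcongr; exact hθ.1) hS.β_theta.1
    obtain ⟨t, ht, v, hv, w, hw, b, hb0, hbs, -, hvn, hwn⟩ := exists_residuals_le
      (δ := τ ^ 2 * m ^ 2 * ε ^ 3 / (ℓ ^ 2 * D)) (s := τ * ε / ℓ) hm hP hS hry hG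
      (by positivity) (by positivity) (by
        calc τ ^ 2 * m ^ 2 * ε ^ 3 / (ℓ ^ 2 * D)
            = ℓ * (m * (m * (ε / D) / ℓ) * (τ * ε / ℓ) ^ 2) := by field_simp
          _ ≤ ℓ * (β * (τ * ε / ℓ) ^ 2) := by gcongr)
    have e1 : ℓ * (τ * ε / ℓ) = τ * ε := by field_simp
    have hry' : ry * D ≤ κ * ε := by
      have := mul_le_mul_of_nonneg_right hθ.2 hD.le
      rwa [mul_assoc κ, div_mul_cancel₀ _ hD.ne'] at this
    refine ⟨t, ht.trans_eq (by field_simp), hv.1, hw.1, ?_, ?_⟩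
    · refine (Metric.infDist_le_dist_of_mem (mem_image_of_mem _ hv)).trans ?_
      rw [dist_zero_left]
      refine hvn.trans ?_
      rw [mul_assoc _ ℓ, e1, ← mul_assoc, hAτ]
      nlinarith
    · refine (Metric.infDist_le_dist_of_mem (mem_image_of_mem _ hw)).trans ?_
      rw [dist_zero_left]
      refine hwn.trans ?_
      have h1 : A * ℓ * b ≤ A * (τ * ε) := by
        rw [mul_assoc, ← e1]; gcongr
      have h2 : 3 * (A * (τ * ε)) = (1 - κ) * ε := by rw [← hAτ]; ring
      have h3 : 0 < (1 - κ) * ε := mul_pos (by linarith) hε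
      linarith
  · intro κ hκ
    set τ := (1 / 4 - κ) / (3 * A) with hτ
    have hτ0 : 0 < τ := div_pos (by linarith) (by positivity)
    have hAτ : 3 * (A * τ) = 1 / 4 - κ := by rw [hτ]; field_simp
    -- The bound `k ≤ m²` keeps `δ ≤ ℓ β s²`, and `k ≤ 1` yields `b ≤ τ ε²/(ℓ² D)`.
    set k := min 1 (m ^ 2) with hk
    have hk0 : 0 < k := lt_min one_pos (by positivity)
    refine ⟨1 / (τ ^ 2 * k), by positivity, ?_⟩
    intro n d X Y f ℓ ε rx ry c α β x y z hP hε hS hry hθ hG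
    have hℓ := hP.smooth.pos
    have hD := hP.diam_pos
    set D := Metric.diam Y with hDdef
    have hκ0 := κ_pos κ ry _ hS.ry_pos (by positivity) hθ.2
    have hβ : m * (m * (ε ^ 2 / (ℓ * D ^ 2)) / ℓ) ≤ β :=
      le_trans (by gcongr; exact hθ.1) hS.β_theta.1
    obtain ⟨t, ht, v, hv, w, hw, b, hb0, -, hbδ, hvn, hwn⟩ := exists_residuals_le
      (δ := τ ^ 2 * k * ε ^ 4 / (ℓ ^ 3 * D ^ 2)) (s := τ * ε / ℓ) hm hP hS hry hG
      (by positivity) (by positivity) (by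
        calc τ ^ 2 * k * ε ^ 4 / (ℓ ^ 3 * D ^ 2)
            ≤ τ ^ 2 * m ^ 2 * ε ^ 4 / (ℓ ^ 3 * D ^ 2) := by gcongr; exact min_le_right _ _
          _ = ℓ * (m * (m * (ε ^ 2 / (ℓ * D ^ 2)) / ℓ) * (τ * ε / ℓ) ^ 2) := by field_simp
          _ ≤ ℓ * (β * (τ * ε / ℓ) ^ 2) := by gcongr)
    have e1 : ℓ * (τ * ε / ℓ) = τ * ε := by field_simp
    have hb : b ≤ τ * ε ^ 2 / (ℓ ^ 2 * D) := by
      refine (sq_le_sq₀ hb0 (by positivity)).1 (le_of_mul_le_mul_left (hbδ.trans ?_) hℓ)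
      calc τ ^ 2 * k * ε ^ 4 / (ℓ ^ 3 * D ^ 2)
          ≤ τ ^ 2 * 1 * ε ^ 4 / (ℓ ^ 3 * D ^ 2) := by gcongr; exact min_le_left _ _
        _ = ℓ * (τ * ε ^ 2 / (ℓ ^ 2 * D)) ^ 2 := by field_simp
    have hbD : ℓ * (A * ℓ * b * D) ≤ A * τ * ε ^ 2 := by
      calc ℓ * (A * ℓ * b * D) ≤ ℓ * (A * ℓ * (τ * ε ^ 2 / (ℓ ^ 2 * D)) * D) := by gcongr
        _ = A * τ * ε ^ 2 := by field_simp
    have hry' : ℓ * (ry * D * D) ≤ κ * ε ^ 2 := by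
      calc ℓ * (ry * D * D) ≤ ℓ * (κ * (ε ^ 2 / (ℓ * D ^ 2)) * D * D) := by
            gcongr; exact hθ.2
        _ = κ * ε ^ 2 := by field_simp
    refine ⟨t, ht.trans_eq (by field_simp), hv.1, ?_⟩
    obtain ⟨p, hp⟩ := exists_isProx hP hv.1
    refine ⟨p, hp, ?_⟩
    have h1 := prox_sq_le hP hp hv hw
    rw [mul_assoc _ ℓ, e1] at hvn
    set r := ‖p - x (t + 1)‖ with hr
    have hr0 : 0 ≤ r := norm_nonneg _
    have h2 := mul_le_mul_of_nonneg_right hwn hD.le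
    have h3 := mul_le_mul_of_nonneg_right hvn hr0
    have h4 : (ℓ * r) ^ 2 ≤ (A * τ + κ) * ε ^ 2 + 3 * (A * τ) * ε * (ℓ * r) := by
      have := mul_le_mul_of_nonneg_left (h1.trans (add_le_add h2 h3)) hℓ.le
      linarith
    rw [le_div_iff₀ (by positivity)]
    -- At `ℓ r = ε/2` the right side of `h4` is `(1/4 - A τ/2) ε²`, below the left side `ε²/4`;
    -- beyond that point the left side stays ahead, since `3 A τ < 1/4`.
    by_contra! h5
    have h6 : 0 < (ℓ * r - ε / 2) := by linarith
    have h7 : 0 < A * τ := by positivity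
    have h8 : 0 < (ℓ * r - ε / 2) * (ℓ * r + ε / 2 - 3 * (A * τ) * ε) :=
      mul_pos h6 (by nlinarith)
    have h9 : 0 < A * τ * ε ^ 2 := by positivity
    have h10 : κ * ε ^ 2 = 1 / 4 * ε ^ 2 - 3 * (A * τ) * ε ^ 2 := by
      rw [hAτ]; ring
    linarith
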